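/- Let $k$ be a field of characteristic $0$ and let $$P=k((x_1))\cdots((x_n))((\partial_1^{-1}))\cdots((\partial_n^{-1}))$$ be the ring of formal pseudo-differential operators in $n$ variables, with product given by the Leibniz rule $$\Big(\sum_\alpha a_\alpha\partial^\alpha\Big)\Big(\sum_\beta b_\beta\partial^\beta\Big)=\sum_{\alpha,\beta;\,\gamma\ge 0}\binom{\alpha}{\gamma}a_\alpha\, d^\gamma(b_\beta)\,\partial^{\alpha+\beta-\gamma},\qquad d_i=\partial/\partial x_i .$$ For $L=\sum a_{i;j}x^i\partial^j\in P$ ($i,j\in\mathbb Z^n$) put $\operatorname{res}_P(L)=a_{-1,\dots,-1;-1,\dots,-1}$. On $P^n$ put $\langle L,M\rangle=\sum_{i=1}^n\operatorname{res}_P(L_iM_i)$ and let $[X,Y]$ be the componentwise commutator. Let $\mathcal F(P^n)$ be the space of functionals on $P^n$ that are polynomials of bounded degree in any (finite or infinite) number of coefficients of $L_1,\dots,L_n$, where at every point of $P^n$ all but finitely many monomials vanish. The gradient $\nabla_F(L)\in P^n$ is defined by $\langle M,\nabla_F(L)\rangle=\frac{d}{d\varepsilon}F(L+\varepsilon M)|_{\varepsilon=0}$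 for all $M\in P^n$. Let $P=P_+\oplus P_-$, where $P_+$ (resp. $P_-$) consists of the operators that contain only powers $\ge 0$ (resp. $<0$) of $\partial_n$, let $RX=X_+-X_-$ (componentwise on $P^n$), and let $[X,Y]_R=\frac12[RX,Y]+\frac12[X,RY]$. Put $$\{F,G\}(L)=\langle L,[\nabla_F(L),\nabla_G(L)]\rangle,\qquad \{F,G\}_R(L)=\langle L,[\nabla_F(L),\nabla_G(L)]_R\rangle .$$ For a multi-index $m=(m_1,\dots,m_n)$ with $m_i\ge 0$ put $H_m(L)=\operatorname{res}_P(L_1^{m_1}\cdots L_n^{m_n})$. Then every $H_m$ belongs to $\mathcal F(P^n)$, and every $F\in\mathcal F(P^n)$ has a unique gradient at every point of $P^n$, so that the brackets make sense. If $L\in P'$, that is, $L\in P^n$ and $[L_i,L_j]=0$ for all $i,j$, then for all multi-indices $m,l$ and all $F\in\mathcal F(P^n)$ $$\text{i)}\ \{H_m,F\}(L)=0,\qquad \text{ii)}\ \{H_m,H_l\}_R(L)=0 .$$ -/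

import Mathlib

/-! ### Iterated Laurent series -/

/-- Exponents `α ∈ ℤⁿ`, ordered lexicographically with the last coordinate most significant. -/
abbrev Expo (n : ℕ) : Type := Colex (Fin n → ℤ)

instance Expo.isOrderedCancelAddMonoid (n : ℕ) : IsOrderedCancelAddMonoid (Expo n) where
  add_le_add_left a b hab c := by
    rcases hab.lt_or_eq with h | h
    · obtain ⟨i, hi, hlt⟩ := h
      exact le_of_lt ⟨i, fun j hj => congrArg (· + c j) (hi j hj), add_lt_add_left hlt (c i)⟩
    · rw [h]
  le_of_add_le_add_left a b c hbc := by
    rcases hbc.lt_or_eq with h | h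
    · obtain ⟨i, hi, hlt⟩ := h
      exact le_of_lt ⟨i, fun j hj => add_left_cancel (hi j hj), lt_of_add_lt_add_left hlt⟩
    · exact (add_left_cancel h).le

/-- The iterated Laurent series `R((t₁))⋯((tₙ))`. A set of exponents is the support of an
iterated Laurent series (the exponents of `tₙ` are bounded below; for each exponent of `tₙ`
those of `tₙ₋₁` are bounded below, and so on) if and only if it is well-ordered for the
lexicographic order in which `tₙ` is most significant, so these are the Hahn series over
`Expo n`. -/
abbrev IterLaurent (n : ℕ) (R : Type*) [Zero R] : Type _ := HahnSeries (Expo n) R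

/-- The derivation `∂/∂xᵢ` of `k((x₁))⋯((xₙ))`. -/
noncomputable def partialDeriv {n : ℕ} {k : Type*} [Field k] (i : Fin n) :
    Module.End k (IterLaurent n k) where
  toFun f :=
    { coeff := fun s => ((s i + 1 : ℤ) : k) * f.coeff (s + toColex (Pi.single i 1))
      isPWO_support' := by
        have hm : Monotone fun s : Expo n => s - toColex (Pi.single i 1) := fun a b h => by
          simpa [sub_eq_add_neg] using add_le_add_left h (-toColex (Pi.single i 1))
        refine (f.isPWO_support.image_of_monotone hm).mono fun s hs => ?_
        exact ⟨s + toColex (Pi.single i 1), right_ne_zero_of_mul hs, by simp⟩ }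
  map_add' f g := by ext s; simp [mul_add]
  map_smul' c f := by ext s; simp [mul_left_comm]

/-- `d^γ = d₁^{γ₁} ⋯ dₙ^{γₙ}`, where `dᵢ = ∂/∂xᵢ`. -/
noncomputable def iterDeriv {n : ℕ} {k : Type*} [Field k] (γ : Fin n → ℕ) :
    Module.End k (IterLaurent n k) :=
  (List.ofFn fun i => partialDeriv i ^ γ i).prod

/-! ### Formal pseudo-differential operators -/

/-- The space `P = k((x₁))⋯((xₙ))((∂₁⁻¹))⋯((∂ₙ⁻¹))` of formal pseudo-differential operators
`∑ a_α ∂^α`, as iterated Laurent series in `∂₁⁻¹, …, ∂ₙ⁻¹` with coefficients in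
`k((x₁))⋯((xₙ))` written on the left. The product is not that of (commutative)
Laurent series; it is defined below. -/
def PsiDO (n : ℕ) (k : Type*) [Field k] : Type _ := IterLaurent n (IterLaurent n k)

namespace PsiDO

noncomputable instance (n : ℕ) (k : Type*) [Field k] : AddCommGroup (PsiDO n k) :=
  inferInstanceAs (AddCommGroup (IterLaurent n (IterLaurent n k)))

noncomputable instance (n : ℕ) (k : Type*) [Field k] : Module k (PsiDO n k) :=
  inferInstanceAs (Module k (IterLaurent n (IterLaurent n k)))

/-- The operator `1 = ∂⁰`. -/
noncomputable instance (n : ℕ) (k : Type*) [Field k] : One (PsiDO n k) :=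
  inferInstanceAs (One (IterLaurent n (IterLaurent n k)))

/-- The coefficient `a_α ∈ k((x₁))⋯((xₙ))` of `∂^α = ∂₁^{α₁} ⋯ ∂ₙ^{αₙ}`. -/
def coeff {n : ℕ} {k : Type*} [Field k] (L : PsiDO n k) (α : Fin n → ℤ) : IterLaurent n k :=
  HahnSeries.coeff L (toColex (-α))

/-- The term `binom(α, γ) a_α d^γ(b_β)` of the Leibniz rule for the product of `∑ a_α ∂^α` and
`∑ b_β ∂^β` that contributes to `∂^δ`, that is, with `α + β - γ = δ`; here `q = (α, γ)`. -/
noncomputable def mulTerm {n : ℕ} {k : Type*} [Field k] (L M : PsiDO n k) (δ : Fin n → ℤ)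
    (q : (Fin n → ℤ) × (Fin n → ℕ)) : IterLaurent n k :=
  (∏ i, Ring.choose (q.1 i) (q.2 i)) •
    (L.coeff q.1 * iterDeriv q.2 (M.coeff fun i => δ i - q.1 i + q.2 i))

/-- The set of the exponents `γ ≥ 0`. -/
def cone (n : ℕ) : Set (Expo n) := Set.range fun γ : Fin n → ℕ => toColex fun i => (γ i : ℤ)

theorem isPWO_cone (n : ℕ) : (cone n).IsPWO := by
  rw [cone, ← Set.image_univ]
  refine Set.IsPWO.image_of_monotone (Set.isPWO_of_wellQuasiOrderedLE _) ?_
  intro γ γ' h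
  exact Pi.toColex_monotone fun i => Int.ofNat_le.mpr (h i)

theorem mulTerm_support {n : ℕ} {k : Type*} [Field k] {L M : PsiDO n k} {δ : Fin n → ℤ}
    {q : (Fin n → ℤ) × (Fin n → ℕ)} (h : mulTerm L M δ q ≠ 0) :
    toColex (-q.1) ∈ HahnSeries.support L ∧
      toColex (-fun i => δ i - q.1 i + q.2 i) ∈ HahnSeries.support M := by
  refine ⟨fun h0 => h ?_, fun h0 => h ?_⟩
  · have : L.coeff q.1 = 0 := h0
    simp [mulTerm, this]
  · have : (M.coeff fun i => δ i - q.1 i + q.2 i) = 0 := h0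
    simp [mulTerm, this]

theorem expo_add_eq {n : ℕ} (δ : Fin n → ℤ) (q : (Fin n → ℤ) × (Fin n → ℕ)) :
    (toColex (-q.1) + (toColex (-fun i => δ i - q.1 i + q.2 i) +
      toColex fun i => (q.2 i : ℤ)) : Expo n) = toColex (-δ) := by
  apply ofColex.injective
  funext i
  change -q.1 i + (-(δ i - q.1 i + q.2 i) + (q.2 i : ℤ)) = -δ i
  ring

open Pointwise in
/-- Only finitely many terms contribute to each coefficient of the product. -/
theorem finite_mulTerm {n : ℕ} {k : Type*} [Field k] (L M : PsiDO n k) (δ : Fin n → ℤ) :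
    (Function.support (mulTerm L M δ)).Finite := by
  have hM : (HahnSeries.support M + cone n).IsPWO :=
    (HahnSeries.isPWO_support M).add (isPWO_cone n)
  have h1 : (Set.antidiagonal (HahnSeries.support L) (HahnSeries.support M + cone n)
      (toColex (-δ))).Finite :=
    Set.AddAntidiagonal.finite_of_isPWO (HahnSeries.isPWO_support L) hM _
  have h2 := h1.biUnion (t := fun p =>
      (fun r : Expo n × Expo n => (p.1, r)) ''
        Set.antidiagonal (HahnSeries.support M) (cone n) p.2)
    fun p _ => (Set.AddAntidiagonal.finite_of_isPWO (HahnSeries.isPWO_support M)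
      (isPWO_cone n) p.2).image _
  let φ : (Fin n → ℤ) × (Fin n → ℕ) → Expo n × Expo n × Expo n := fun q =>
    (toColex (-q.1), toColex (-fun i => δ i - q.1 i + q.2 i), toColex fun i => (q.2 i : ℤ))
  have hφ : Function.Injective φ := by
    rintro ⟨a, c⟩ ⟨a', c'⟩ h
    have ha : a = a' := neg_injective (toColex.injective (congrArg Prod.fst h))
    have hc : (fun i => (c i : ℤ)) = fun i => (c' i : ℤ) :=
      toColex.injective (congrArg (fun z => z.2.2) h)
    rw [ha, show c = c' from funext fun i => Int.ofNat_injective (congrFun hc i)]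
  refine Set.Finite.of_finite_image (h2.subset ?_) hφ.injOn
  rintro _ ⟨q, hq, rfl⟩
  obtain ⟨hL, hM'⟩ := mulTerm_support hq
  refine Set.mem_biUnion (x := (toColex (-q.1), toColex (-fun i => δ i - q.1 i + q.2 i) +
    toColex fun i => (q.2 i : ℤ))) ?_ ?_
  · exact ⟨hL, Set.add_mem_add hM' ⟨q.2, rfl⟩, expo_add_eq δ q⟩
  · exact ⟨_, ⟨hM', ⟨q.2, rfl⟩, rfl⟩, rfl⟩

open Pointwise in
/-- The product of pseudo-differential operators, given by the Leibniz rule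
`(∑ a_α ∂^α)(∑ b_β ∂^β) = ∑_{α, β, γ ≥ 0} binom(α, γ) a_α d^γ(b_β) ∂^{α + β - γ}`. -/
noncomputable instance (n : ℕ) (k : Type*) [Field k] : Mul (PsiDO n k) where
  mul L M := show HahnSeries (Expo n) (IterLaurent n k) from
    { coeff := fun s => ∑ᶠ q, mulTerm L M (-ofColex s) q
      isPWO_support' := by
        refine ((HahnSeries.isPWO_support L).add
          ((HahnSeries.isPWO_support M).add (isPWO_cone n))).mono fun s hs => ?_
        obtain ⟨q, hq⟩ : ∃ q, mulTerm L M (-ofColex s) q ≠ 0 := by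
          by_contra h
          exact hs (finsum_eq_zero_of_forall_eq_zero fun q => not_not.mp (not_exists.mp h q))
        obtain ⟨hL, hM⟩ := mulTerm_support hq
        have h := expo_add_eq (-ofColex s) q
        rw [neg_neg] at h
        exact ⟨_, hL, _, ⟨_, hM, _, ⟨q.2, rfl⟩, rfl⟩, h⟩ }

/-- The commutator `[L, M] = L M - M L`. -/
noncomputable instance (n : ℕ) (k : Type*) [Field k] : Bracket (PsiDO n k) (PsiDO n k) where
  bracket L M := L * M - M * L

/-- The residue `res_P(∑ a_{i; j} x^i ∂^j) = a_{-1, …, -1; -1, …, -1}`. -/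
def residue {n : ℕ} {k : Type*} [Field k] (L : PsiDO n k) : k :=
  (L.coeff fun _ => -1).coeff (toColex fun _ => -1)

/-- The terms `a_α ∂^α` of an operator with `α` in a given set. -/
noncomputable def restrict {n : ℕ} {k : Type*} [Field k] (A : Set (Fin n → ℤ)) (L : PsiDO n k) :
    PsiDO n k :=
  show HahnSeries (Expo n) (IterLaurent n k) from
    { coeff := ({s | -ofColex s ∈ A} : Set (Expo n)).indicator (HahnSeries.coeff L)
      isPWO_support' := (HahnSeries.isPWO_support L).mono fun s hs => by
        classical
        intro h0
        apply hs
        rw [Set.indicator_apply]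
        split_ifs
        · exact h0
        · rfl }

/-- The exponents whose last coordinate, the exponent of `∂ₙ`, is nonnegative. -/
def lastNonneg (n : ℕ) : Set (Fin n → ℤ) := {α | ∀ i : Fin n, (i : ℕ) + 1 = n → 0 ≤ α i}

/-- The component `L₊` of `L` in `P = P₊ + P₋`: the powers `≥ 0` of `∂ₙ`. -/
noncomputable def plusPart {n : ℕ} {k : Type*} [Field k] (L : PsiDO n k) : PsiDO n k :=
  restrict (lastNonneg n) L

/-- The component `L₋` of `L` in `P = P₊ + P₋`: the powers `< 0` of `∂ₙ`. -/
noncomputable def minusPart {n : ℕ} {k : Type*} [Field k] (L : PsiDO n k) : PsiDO n k :=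
  restrict (lastNonneg n)ᶜ L

/-! ### The space `Pⁿ` -/

/-- The variety `P'` of the `n`-tuples of operators that commute with each other. -/
def commutingVariety (n : ℕ) (k : Type*) [Field k] : Set (Fin n → PsiDO n k) :=
  {L | ∀ i j, ⁅L i, L j⁆ = 0}

/-- The monomial `L^m = L₁^{m₁} ⋯ Lₙ^{mₙ}`. -/
noncomputable def multiPow {n : ℕ} {k : Type*} [Field k] (L : Fin n → PsiDO n k)
    (m : Fin n → ℕ) : PsiDO n k :=
  (List.ofFn fun i => npowRec (m i) (L i)).prod

/-- The function `H_m(L) = res_P(L^m)` on `Pⁿ`. -/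
noncomputable def hamiltonian {n : ℕ} {k : Type*} [Field k] (m : Fin n → ℕ)
    (L : Fin n → PsiDO n k) : k :=
  residue (multiPow L m)

/-- The pairing `⟨L, M⟩ = ∑ res_P(Lᵢ Mᵢ)` on `Pⁿ`. -/
noncomputable def pairing {n : ℕ} {k : Type*} [Field k] (L M : Fin n → PsiDO n k) : k :=
  ∑ i, residue (L i * M i)

/-- The Lie bracket of `Pⁿ`, taken componentwise. -/
noncomputable def lie {n : ℕ} {k : Type*} [Field k] (X Y : Fin n → PsiDO n k) :
    Fin n → PsiDO n k :=
  fun i => ⁅X i, Y i⁆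

/-- The `R`-matrix `R X = X₊ - X₋`, the difference of the projectors. -/
noncomputable def rMatrix {n : ℕ} {k : Type*} [Field k] (X : Fin n → PsiDO n k) :
    Fin n → PsiDO n k :=
  fun i => plusPart (X i) - minusPart (X i)

/-- The Lie bracket `[X, Y]_R = ½ [R X, Y] + ½ [X, R Y]` of `Pⁿ`. -/
noncomputable def lieR {n : ℕ} {k : Type*} [Field k] (X Y : Fin n → PsiDO n k) :
    Fin n → PsiDO n k :=
  (2⁻¹ : k) • lie (rMatrix X) Y + (2⁻¹ : k) • lie X (rMatrix Y)

/-! ### Functionals, gradients and Poisson brackets -/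

/-- The coordinate functions on `Pⁿ`: `(i, α, β)` stands for the coefficient of `x^α ∂^β`
in `Lᵢ`. -/
abbrev CoordIndex (n : ℕ) : Type := Fin n × (Fin n → ℤ) × (Fin n → ℤ)

/-- The value of a coordinate function. -/
def coord {n : ℕ} {k : Type*} [Field k] (L : Fin n → PsiDO n k) (v : CoordIndex n) : k :=
  ((L v.1).coeff v.2.2).coeff (toColex v.2.1)

/-- The value at `L` of the monomial `c m · ∏ v^{m v}` in the coordinates `v`. -/
noncomputable def monomialValue {n : ℕ} {k : Type*} [Field k] (c : (CoordIndex n →₀ ℕ) → k)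
    (L : Fin n → PsiDO n k) (m : CoordIndex n →₀ ℕ) : k :=
  c m * m.prod fun v e => coord L v ^ e

/-- The space `ℱ(Pⁿ)` of functionals: polynomials (of bounded degree) in any number, finite or
infinite, of coordinates; at each point of `Pⁿ` all but finitely many of their monomials
vanish. -/
def functionals (n : ℕ) (k : Type*) [Field k] : Set ((Fin n → PsiDO n k) → k) :=
  {F | ∃ c : (CoordIndex n →₀ ℕ) → k,
    (∃ N : ℕ, ∀ m, c m ≠ 0 → m.degree ≤ N) ∧
    ∀ L, (Function.support (monomialValue c L)).Finite ∧ F L = ∑ᶠ m, monomialValue c L m}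

/-- `c` is the derivative `d/dε F(L + ε M)` at `ε = 0`: along the line, `F` is given by a
polynomial in `ε` whose derivative at `0` is `c`. -/
def HasDerivAlong {n : ℕ} {k : Type*} [Field k] (F : (Fin n → PsiDO n k) → k)
    (L M : Fin n → PsiDO n k) (c : k) : Prop :=
  ∃ p : Polynomial k, (∀ ε : k, F (L + ε • M) = p.eval ε) ∧ p.derivative.eval 0 = c

/-- `U` is the gradient of `F` at `L`: `⟨M, U⟩ = d/dε F(L + ε M)` at `ε = 0`, for all `M`. -/
def IsGradient {n : ℕ} {k : Type*} [Field k] (F : (Fin n → PsiDO n k) → k)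
    (L U : Fin n → PsiDO n k) : Prop :=
  ∀ M, HasDerivAlong F L M (pairing M U)

open Classical in
/-- The gradient `∇_F(L)` (and `0` if there is none). -/
noncomputable def gradient {n : ℕ} {k : Type*} [Field k] (F : (Fin n → PsiDO n k) → k)
    (L : Fin n → PsiDO n k) : Fin n → PsiDO n k :=
  if h : ∃ U, IsGradient F L U then h.choose else 0

/-- The Poisson bracket `{F, G}(L) = ⟨L, [∇_F(L), ∇_G(L)]⟩`. -/
noncomputable def poisson {n : ℕ} {k : Type*} [Field k] (F G : (Fin n → PsiDO n k) → k)
    (L : Fin n → PsiDO n k) : k :=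
  pairing L (lie (gradient F L) (gradient G L))

/-- The Poisson bracket `{F, G}_R(L) = ⟨L, [∇_F(L), ∇_G(L)]_R⟩`. -/
noncomputable def poissonR {n : ℕ} {k : Type*} [Field k] (F G : (Fin n → PsiDO n k) → k)
    (L : Fin n → PsiDO n k) : k :=
  pairing L (lieR (gradient F L) (gradient G L))

end PsiDO

/-! On an associative algebra with a trace the pairing is invariant: `⟨L, [X, Y]⟩ = ∑ res([Lᵢ, Xᵢ]
Yᵢ)`, which vanishes as soon as every `Xᵢ` commutes with `Lᵢ`, and symmetrically in `Y`
(`pairing_lie_eq_zero_left`, `pairing_lie_eq_zero_right`). At a commuting tuple the gradient of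
`res(L^m)` is `mᵢ L^(m - eᵢ)`, whose entries commute with all `Lⱼ`; only this commutation is needed,
and it is proved by induction over products (`HasCommutingGradient.mul`). This gives i). In ii) each
half of `[X, Y]_R` keeps one gradient unmodified, so both halves vanish, whatever `R` does to the
other one.

Most of the work is the foundation. In terms of the coefficients of the monomials `x^a ∂^α`, the
product has integer structure constants that factor over the variables (`cf_mul`). Associativity
comes from Vandermonde's identity (`weight_assoc`), the trace property from upper negation of
binomials (`weight_reflect`).

For gradients, twisting the symbol of `U` by `exp(-∑ ∂²/∂xᵢ∂ξᵢ)` turns `res(M U)` into a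
coefficientwise pairing (`residue_mul_eq`). The twist is inverted by the opposite exponential, so
the pairing is nondegenerate and represents every linear form `∑ D_p M_p` that is a finite sum at
each `M`. Along a line only finitely many monomials of a functional survive
(`finite_linePoly_ne_zero`), so its differential is such a form. -/

namespace PsiDO

variable {n : ℕ} {k : Type*} [Field k]

/-! ### Binomial identities for one variable -/

open Finset in
theorem sum_antidiagonal_assoc {A : Type*} [AddCommMonoid A] (F : ℕ → ℕ → ℕ → A) (n : ℕ) :
    ∑ x ∈ antidiagonal n, ∑ y ∈ antidiagonal x.2, F x.1 y.1 y.2 =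
      ∑ x ∈ antidiagonal n, ∑ y ∈ antidiagonal x.2, F y.1 x.1 y.2 := by
  rw [Finset.sum_sigma', Finset.sum_sigma']
  refine Finset.sum_nbij' (fun z => ⟨(z.2.1, z.1.1 + z.2.2), (z.1.1, z.2.2)⟩)
    (fun z => ⟨(z.2.1, z.1.1 + z.2.2), (z.1.1, z.2.2)⟩) ?_ ?_ ?_ ?_ ?_
  · rintro ⟨⟨a, b⟩, ⟨c, d⟩⟩ h
    simp only [mem_sigma, HasAntidiagonal.mem_antidiagonal] at h ⊢
    exact ⟨by omega, trivial⟩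
  · rintro ⟨⟨a, b⟩, ⟨c, d⟩⟩ h
    simp only [mem_sigma, HasAntidiagonal.mem_antidiagonal] at h ⊢
    exact ⟨by omega, trivial⟩
  · rintro ⟨⟨a, b⟩, ⟨c, d⟩⟩ h
    simp only [mem_sigma, HasAntidiagonal.mem_antidiagonal] at h ⊢
    obtain ⟨h1, rfl⟩ := h
    rfl
  · rintro ⟨⟨a, b⟩, ⟨c, d⟩⟩ h
    simp only [mem_sigma, HasAntidiagonal.mem_antidiagonal] at h ⊢
    obtain ⟨h1, rfl⟩ := h
    rfl
  · rintro ⟨⟨a, b⟩, ⟨c, d⟩⟩ h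
    rfl

/-- The coefficient of `x^(a + b - g) ∂^(α + β - g)` in the product of `x^a ∂^α` and `x^b ∂^β`,
in one variable. -/
def weight (α b : ℤ) (g : ℕ) : ℤ := Ring.choose α g * (Ring.choose b g * g.factorial)

theorem choose_mul_choose_sub (c : ℤ) (g j : ℕ) :
    Ring.choose c g * Ring.choose (c - g) j = (g + j).choose g * Ring.choose c (g + j) := by
  have := Ring.choose_smul_choose c (Nat.le_add_right g j)
  rw [Nat.add_sub_cancel_left, nsmul_eq_mul] at this
  exact_mod_cast this.symm

theorem factorial_add_eq (i j : ℕ) :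
    ((i + j).factorial : ℤ) = (i + j).choose i * (i.factorial * j.factorial) := by
  rw [← Nat.choose_mul_factorial_mul_factorial (Nat.le_add_right i j), Nat.add_sub_cancel_left]
  push_cast
  ring

-- One-variable associativity. Both sides count `g` factors of `∂^β` acting on `x^c`, `i` factors of
-- `∂^α` acting on `x^b` and `j` factors of `∂^α` acting on `x^c`. Vandermonde's identity splits the
-- mixed binomial on either side, and the same `F g i j` appears with the sums nested differently.
open Finset in
theorem weight_assoc (α b β c : ℤ) (n : ℕ) :
    ∑ x ∈ antidiagonal n, weight α b x.1 * weight (α + β - x.1) c x.2 =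
      ∑ x ∈ antidiagonal n, weight β c x.1 * weight α (b + c - x.1) x.2 := by
  let F : ℕ → ℕ → ℕ → ℤ := fun g i j =>
    Ring.choose β g * Ring.choose c (g + j) * Ring.choose b i * Ring.choose α i *
      Ring.choose (α - i) j * (i.factorial * (g + j).factorial)
  have hR : ∀ x : ℕ × ℕ, weight β c x.1 * weight α (b + c - x.1) x.2 =
      ∑ y ∈ antidiagonal x.2, F x.1 y.1 y.2 := by
    rintro ⟨g, g'⟩
    simp only [weight, F]
    rw [add_sub_assoc, Ring.add_choose_eq g' (Commute.all b (c - g)), sum_mul, mul_sum, mul_sum]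
    refine sum_congr rfl fun y hy => ?_
    obtain ⟨i, j⟩ := y
    rw [HasAntidiagonal.mem_antidiagonal] at hy
    subst hy
    have h1 := choose_mul_choose_sub c g j
    have h2 := choose_mul_choose_sub α i j
    have h3 := factorial_add_eq g j
    have h4 := factorial_add_eq i j
    simp only
    rw [h4, h3]
    linear_combination (Ring.choose β g * (g.factorial) * Ring.choose α (i + j) * Ring.choose b i *
      ((i + j).choose i * (i.factorial * j.factorial))) * h1 -
      Ring.choose β g * Ring.choose c (g + j) * Ring.choose b i * (i.factorial) *
      ((g + j).choose g * (g.factorial * j.factorial)) * h2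
  have hL : ∀ x : ℕ × ℕ, weight α b x.1 * weight (α + β - x.1) c x.2 =
      ∑ y ∈ antidiagonal x.2, F y.1 x.1 y.2 := by
    rintro ⟨i, g'⟩
    simp only [weight, F]
    rw [show α + β - (i : ℤ) = β + (α - i) by ring,
      Ring.add_choose_eq g' (Commute.all β (α - i)), sum_mul, mul_sum]
    refine sum_congr rfl fun y hy => ?_
    obtain ⟨g, j⟩ := y
    rw [HasAntidiagonal.mem_antidiagonal] at hy
    subst hy
    ring
  simp only [hR, hL]
  exact (sum_antidiagonal_assoc F n).symm

theorem choose_sub_one_sub (a : ℤ) (g : ℕ) :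
    Ring.choose ((g : ℤ) - 1 - a) g = (-1) ^ g * Ring.choose a g := by
  rw [show (g : ℤ) - 1 - a = -(a - g + 1) by ring, Ring.choose_neg]
  rw [show a - g + 1 + (g : ℤ) - 1 = a by ring, Int.negOnePow_def]
  simp [Units.smul_def]

/-- Upper negation produces the sign `(-1) ^ g` on both sides. The terms of `x^a ∂^α · x^b ∂^β` that
reach `x^(-1) ∂^(-1)` have `a + b = α + β = g - 1`, so this symmetry makes the residue a trace. -/
theorem weight_reflect (α a : ℤ) (g : ℕ) :
    weight α ((g : ℤ) - 1 - a) g = weight ((g : ℤ) - 1 - α) a g := by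
  simp only [weight, choose_sub_one_sub]
  ring

theorem weight_neg_one_sub (β b : ℤ) (g : ℕ) :
    weight (-1 - β) b g = (-1) ^ g * weight (β + g) b g := by
  have := choose_sub_one_sub (β + g) g
  rw [show (g : ℤ) - 1 - (β + g) = -1 - β by ring] at this
  simp only [weight, this]
  ring

theorem weight_zero (α b : ℤ) : weight α b 0 = 1 := by simp [weight]

-- The identity `exp(εD) exp(-εD) = 1` for `D = ∂²/∂x∂ξ`, on monomials. Trinomial revision reduces
-- each summand to a constant times `(-1) ^ g' * n.choose g'`, and the alternating binomial sum
-- vanishes for `n ≠ 0`.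
open Finset in
theorem sum_weight_inverse (ε : ℤ) (b β : ℤ) (n : ℕ) :
    ∑ x ∈ antidiagonal n, (ε ^ x.1 * weight (β + x.1) (b + x.1) x.1) *
      ((-ε) ^ x.2 * weight (β + n) (b + n) x.2) = if n = 0 then 1 else 0 := by
  have h : ∀ x ∈ antidiagonal n, (ε ^ x.1 * weight (β + x.1) (b + x.1) x.1) *
      ((-ε) ^ x.2 * weight (β + n) (b + n) x.2) =
      (ε ^ n * (Ring.choose (β + n) n * Ring.choose (b + n) n * n.factorial)) *
        ((-1) ^ x.2 * n.choose x.2) := by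
    rintro ⟨g, g'⟩ hx
    rw [HasAntidiagonal.mem_antidiagonal] at hx
    subst hx
    have key : ∀ r : ℤ, Ring.choose (r + ((g + g' : ℕ) : ℤ)) g' * Ring.choose (r + g) g =
        (g + g').choose g' * Ring.choose (r + ((g + g' : ℕ) : ℤ)) (g + g') := by
      intro r
      have := Ring.choose_add_smul_choose (r + g) g g'
      rw [nsmul_eq_mul] at this
      push_cast
      rw [← add_assoc]
      exact_mod_cast this.symm
    have h1 := key β
    have h2 := key b
    have h3 := factorial_add_eq g' g
    rw [add_comm g' g] at h3
    have h4 : (-ε) ^ g' = (-1) ^ g' * ε ^ g' := by rw [neg_pow]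
    simp only [weight, h4, pow_add]
    rw [h3]
    linear_combination (ε ^ g * ε ^ g' * (-1) ^ g' * (g'.factorial * g.factorial)) *
      (Ring.choose (b + ((g + g' : ℕ) : ℤ)) g' * Ring.choose (b + g) g) * h1 +
      (ε ^ g * ε ^ g' * (-1) ^ g' * (g'.factorial * g.factorial)) *
      ((g + g').choose g' * Ring.choose (β + ((g + g' : ℕ) : ℤ)) (g + g')) * h2
  rw [sum_congr rfl h, ← mul_sum]
  have h5 : ∑ x ∈ antidiagonal n, (-1 : ℤ) ^ x.2 * (n.choose x.2 : ℤ) = if n = 0 then 1 else 0 := by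
    rw [← Int.alternating_sum_range_choose,
      ← Nat.sum_antidiagonal_eq_sum_range_succ_mk (fun x => (-1 : ℤ) ^ x.1 * (n.choose x.1 : ℤ)) n,
      ← Nat.sum_antidiagonal_swap]
    rfl
  rw [h5]
  split_ifs with hn
  · subst hn; simp
  · simp

/-! ### Finite sums over infinite index types -/

/-- The basic tool for regrouping coefficient sums. Finite support is essential, since a `finsum`
with infinite support has the default value 0. -/
theorem finsum_fiberwise {A X Y : Type*} [AddCommMonoid A] (π : X → Y) (f : X → A)
    (hf : (Function.support f).Finite) :
    ∑ᶠ x, f x = ∑ᶠ y, ∑ᶠ x, (open Classical in if π x = y then f x else 0) := by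
  classical
  have h := finsum_curry (fun z : Y × X => if π z.2 = z.1 then f z.2 else 0) (by
    refine (hf.image fun x => (π x, x)).subset ?_
    rintro ⟨y, x⟩ h
    rw [Function.mem_support, ne_eq, ite_eq_right_iff, Classical.not_imp] at h
    exact ⟨x, h.2, by simpa using h.1⟩)
  have h' := finsum_curry (fun z : X × Y => if π z.1 = z.2 then f z.1 else 0) (by
    refine (hf.image fun x => (x, π x)).subset ?_
    rintro ⟨x, y⟩ h
    rw [Function.mem_support, ne_eq, ite_eq_right_iff, Classical.not_imp] at h
    exact ⟨x, h.2, by simpa using h.1⟩)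
  have e : ∑ᶠ z : X × Y, (if π z.1 = z.2 then f z.1 else 0) =
      ∑ᶠ z : Y × X, (if π z.2 = z.1 then f z.2 else 0) :=
    finsum_comp_equiv (Equiv.prodComm X Y) (f := fun z : Y × X => if π z.2 = z.1 then f z.2 else 0)
  have e2 : ∀ x, ∑ᶠ y, (if π x = y then f x else 0) = f x := fun x => by
    rw [finsum_eq_single _ (π x) fun y hy => if_neg fun h => hy h.symm, if_pos rfl]
  calc ∑ᶠ x, f x = ∑ᶠ x, ∑ᶠ y, (if π x = y then f x else 0) := finsum_congr fun x => (e2 x).symm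
    _ = _ := by rw [← h', e, h]

theorem finsum_mul_finsum {R X Y : Type*} [NonUnitalNonAssocSemiring R] (f : X → R) (g : Y → R)
    (hf : (Function.support f).Finite) (hg : (Function.support g).Finite) :
    (∑ᶠ x, f x) * ∑ᶠ y, g y = ∑ᶠ z : X × Y, f z.1 * g z.2 := by
  rw [finsum_curry]
  · rw [finsum_mul' _ _ hf]
    exact finsum_congr fun x => mul_finsum' _ _ hg
  · refine (hf.prod hg).subset ?_
    rintro ⟨x, y⟩ h
    exact ⟨fun h0 => h (by simp [h0]), fun h0 => h (by simp [h0])⟩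

/-! ### Bidegrees and admissible supports -/

/-- The pairs `(a, α)` of exponents of the monomials `x^a ∂^α`. -/
abbrev Bideg (n : ℕ) : Type := (Fin n → ℤ) × (Fin n → ℤ)

/-- The bidegree of `x^γ ∂^γ`. -/
def diag (γ : Fin n → ℕ) : Bideg n := (fun i => (γ i : ℤ), fun i => (γ i : ℤ))

theorem diag_add (γ γ' : Fin n → ℕ) : diag (γ + γ') = diag γ + diag γ' := by
  ext i <;> simp [diag]

theorem diag_zero : diag (0 : Fin n → ℕ) = 0 := rfl

/-- The position of the monomial `x^a ∂^α` in the iterated Laurent series. -/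
def key (p : Bideg n) : Expo n ×ₗ Expo n := toLex (toColex (-p.2), toColex p.1)

theorem key_add (p q : Bideg n) : key (p + q) = key p + key q := by
  simp only [key, Prod.snd_add, Prod.fst_add, neg_add]
  rfl

theorem key_sub (p q : Bideg n) : key (p - q) = key p - key q := by
  rw [eq_sub_iff_add_eq, ← key_add, sub_add_cancel]

theorem key_injective : Function.Injective (key (n := n)) := by
  rintro ⟨a, α⟩ ⟨b, β⟩ h
  have h1 := congrArg (fun z => ofColex (ofLex z).1) h
  have h2 := congrArg (fun z => ofColex (ofLex z).2) h
  simp only [key, ofLex_toLex, ofColex_toColex] at h1 h2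
  rw [neg_inj.mp h1, h2]

theorem key_surjective : Function.Surjective (key (n := n)) := fun z =>
  ⟨(ofColex (ofLex z).2, -ofColex (ofLex z).1), by simp [key]⟩

/-- Differentiating more lowers the exponents of `x` but raises those of `∂⁻¹`, and the latter are
compared first. -/
theorem key_neg_diag_mono : Monotone fun γ : Fin n → ℕ => key (-diag γ) := by
  intro γ γ' h
  rcases h.eq_or_lt with rfl | h'
  · exact le_rfl
  · refine Prod.Lex.left _ _ ?_
    refine lt_of_le_of_ne (Pi.toColex_monotone fun i => ?_) fun h0 => h'.ne ?_
    · simpa [diag] using h i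
    · have := toColex.injective h0
      funext i
      simpa [diag] using congrFun this i

/-- The sets of bidegrees that are allowed as supports. -/
def IsSmall (S : Set (Bideg n)) : Prop := (key '' S).IsPWO

theorem IsSmall.mono {S T : Set (Bideg n)} (hT : IsSmall T) (h : S ⊆ T) : IsSmall S :=
  Set.IsPWO.mono hT (Set.image_mono h)

theorem _root_.Set.Finite.isSmall {S : Set (Bideg n)} (h : S.Finite) : IsSmall S :=
  (h.image _).isPWO

theorem isPWO_neg_diag : (Set.range fun γ : Fin n → ℕ => key (-diag γ)).IsPWO := by
  rw [← Set.image_univ]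
  exact Set.IsPWO.image_of_monotone (Set.isPWO_of_wellQuasiOrderedLE _) key_neg_diag_mono

open Pointwise in
theorem IsSmall.add_sub_diag {S T : Set (Bideg n)} (hS : IsSmall S) (hT : IsSmall T) :
    IsSmall {s | ∃ p ∈ S, ∃ q ∈ T, ∃ γ, p + q - diag γ = s} := by
  refine Set.IsPWO.mono ((Set.IsPWO.add hS hT).add isPWO_neg_diag) ?_
  rintro _ ⟨_, ⟨p, hp, q, hq, γ, rfl⟩, rfl⟩
  refine ⟨_, ⟨_, ⟨p, hp, rfl⟩, _, ⟨q, hq, rfl⟩, rfl⟩, _, ⟨γ, rfl⟩, ?_⟩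
  simp only [sub_eq_add_neg, key_add]

/-- The sum `key p + key q + key (-diag γ)` is strictly monotone in the triple, so the triples with
a given sum form an antichain; an antichain in a partially well-ordered set is finite. -/
theorem IsSmall.finite_add_sub_diag {S T : Set (Bideg n)} (hS : IsSmall S) (hT : IsSmall T)
    (e : Bideg n) :
    {z : Bideg n × Bideg n × (Fin n → ℕ) |
      z.1 ∈ S ∧ z.2.1 ∈ T ∧ z.1 + z.2.1 - diag z.2.2 = e}.Finite := by
  let X := (Expo n ×ₗ Expo n) × (Expo n ×ₗ Expo n) × (Fin n → ℕ)
  let σ : X → Expo n ×ₗ Expo n := fun z => z.1 + z.2.1 + key (-diag z.2.2)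
  let A : Set X := {z | z ∈ (key '' S) ×ˢ ((key '' T) ×ˢ Set.univ) ∧ σ z = key e}
  have hA : A.IsPWO :=
    (Set.IsPWO.prod hS (Set.IsPWO.prod hT (Set.isPWO_of_wellQuasiOrderedLE _))).mono
      fun z hz => hz.1
  have hanti : IsAntichain (· ≤ ·) A := by
    rintro ⟨a, b, γ⟩ ⟨_, h1⟩ ⟨a', b', γ'⟩ ⟨_, h2⟩ hne hle
    apply hne
    obtain ⟨ha, hb, hγ⟩ := hle
    change a + b + key (-diag γ) = key e at h1
    change a' + b' + key (-diag γ') = key e at h2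
    have hγ' := key_neg_diag_mono hγ
    have e3 : key (-diag γ) = key (-diag γ') := by
      refine le_antisymm hγ' (not_lt.mp fun hlt => ?_)
      exact absurd (h1.trans h2.symm) (add_lt_add_of_le_of_lt (add_le_add ha hb) hlt).ne
    have e12 : a + b = a' + b' := by
      rw [e3] at h1; exact add_right_cancel (h1.trans h2.symm)
    have e2 : b = b' := by
      refine le_antisymm hb (not_lt.mp fun hlt => ?_)
      exact absurd e12 (add_lt_add_of_le_of_lt ha hlt).ne
    have e1 : a = a' := by rw [e2] at e12; exact add_right_cancel e12
    have e4 : γ = γ' := by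
      have := key_injective e3
      funext i
      simpa [diag] using congrFun (congrArg Prod.fst this) i
    rw [e1, e2, e4]
  have hfin : A.Finite := hanti.finite_of_partiallyWellOrderedOn hA
  refine Set.Finite.of_finite_image (f := fun z => ((key z.1, key z.2.1, z.2.2) : X))
    (hfin.subset ?_) ?_
  · rintro _ ⟨⟨p, q, γ⟩, ⟨hp, hq, h⟩, rfl⟩
    refine ⟨⟨⟨p, hp, rfl⟩, ⟨q, hq, rfl⟩, trivial⟩, ?_⟩
    simp only at h
    simp only [σ, ← key_add, ← h, sub_eq_add_neg]
  · rintro ⟨p, q, γ⟩ _ ⟨p', q', γ'⟩ _ h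
    simp only [Prod.mk.injEq] at h
    rw [key_injective h.1, key_injective h.2.1, h.2.2]

/-- If the set `S` meets every small set in a finite set, then its reflections are small. -/
theorem isSmall_of_finite_inter (S : Set (Bideg n)) (e : Bideg n)
    (h : ∀ T, IsSmall T → (S ∩ T).Finite) : IsSmall {p | e - p ∈ S} := by
  unfold IsSmall
  refine Set.IsWF.isPWO (Set.isWF_iff_no_descending_seq.mpr ?_)
  -- A descending sequence of keys reflects to an ascending one in `S`, whose range is small and
  -- infinite, contrary to `h`.
  intro f hf hmem
  choose p hp hpf using hmem
  have hkey : ∀ m, key (e - p m) = key e - f m := fun m => by rw [key_sub, hpf]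
  have hinj : Function.Injective fun m => e - p m := by
    intro a b hab
    apply hf.injective
    rw [← hpf, ← hpf, sub_right_injective hab]
  have hsmall : IsSmall (Set.range fun m => e - p m) := by
    unfold IsSmall
    rw [← Set.image_univ, ← Set.image_comp]
    refine Set.IsPWO.image_of_monotone (Set.isPWO_of_wellQuasiOrderedLE _) ?_
    intro a b hab
    simp only [Function.comp, hkey]
    exact sub_le_sub_left (hf.antitone hab) _
  refine Set.infinite_range_of_injective hinj ((h _ hsmall).subset ?_)
  rintro _ ⟨m, rfl⟩
  exact ⟨hp m, m, rfl⟩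

/-! ### Coefficients and the Leibniz product -/

/-- The coefficient of `x^a ∂^α`, where `p = (a, α)`. -/
def cf (L : PsiDO n k) (p : Bideg n) : k := (L.coeff p.2).coeff (toColex p.1)

theorem cf_injective : Function.Injective (cf : PsiDO n k → Bideg n → k) := by
  intro L M h
  apply (HahnSeries.iterateEquiv (Γ := Expo n) (Γ' := Expo n) (R := k)).injective
  ext z
  obtain ⟨p, rfl⟩ := key_surjective z
  exact congrFun h p

theorem isSmall_support_cf (L : PsiDO n k) : IsSmall (Function.support (cf L)) := by
  refine Set.IsPWO.mono
    (HahnSeries.iterateEquiv (Γ := Expo n) (Γ' := Expo n) (R := k) L).isPWO_support ?_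
  rintro _ ⟨p, hp, rfl⟩
  exact hp

theorem exists_cf_eq (f : Bideg n → k) (hf : IsSmall (Function.support f)) :
    ∃ L : PsiDO n k, cf L = f := by
  let g : HahnSeries (Expo n ×ₗ Expo n) k :=
    { coeff := fun z => f (ofColex (ofLex z).2, -ofColex (ofLex z).1)
      isPWO_support' := Set.IsPWO.mono hf fun z hz =>
        ⟨_, hz, by simp [key]⟩ }
  refine ⟨HahnSeries.iterateEquiv.symm g, funext fun p => ?_⟩
  change f (p.1, -(-p.2)) = f p
  rw [neg_neg]

theorem cf_zero : cf (0 : PsiDO n k) = 0 := rfl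

theorem cf_add (L M : PsiDO n k) : cf (L + M) = cf L + cf M := rfl

theorem cf_smul (c : k) (L : PsiDO n k) : cf (c • L) = c • cf L := rfl

theorem cf_one (p : Bideg n) : cf (1 : PsiDO n k) p = if p = 0 then 1 else 0 := by
  change HahnSeries.coeff (HahnSeries.coeff (1 : HahnSeries (Expo n) (IterLaurent n k))
    (toColex (-p.2))) (toColex p.1) = _
  obtain ⟨a, α⟩ := p
  rw [HahnSeries.coeff_one]
  by_cases hα : α = 0
  · subst hα
    rw [if_pos (by simp), HahnSeries.coeff_one]
    by_cases ha : a = 0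
    · subst ha; simp
    · rw [if_neg, if_neg]
      · simpa using ha
      · exact fun h => ha (toColex.injective h)
  · rw [if_neg, HahnSeries.coeff_zero, if_neg]
    · simp [hα]
    · exact fun h => hα (neg_eq_zero.mp (toColex.injective h))

theorem residue_eq_cf (L : PsiDO n k) : residue L = cf L (-1) := rfl

/-- The coefficient of `x^(a + b - γ) ∂^(α + β - γ)` in the product of `x^a ∂^α` and `x^b ∂^β`,
where `p = (a, α)` and `q = (b, β)`. -/
def multiWeight (p q : Bideg n) (γ : Fin n → ℕ) : ℤ := ∏ i, weight (p.2 i) (q.1 i) (γ i)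

theorem finsum_eq_finsum_comp {A X Y : Type*} [AddCommMonoid A] (φ : X → Y)
    (hφ : Function.Injective φ) (f : Y → A) (hf : Function.support f ⊆ Set.range φ) :
    ∑ᶠ y, f y = ∑ᶠ x, f (φ x) := by
  rw [← finsum_mem_range hφ]
  refine finsum_congr fun y => ?_
  by_cases hy : y ∈ Set.range φ
  · simp [finsum_eq_if, hy]
  · have : f y = 0 := by
      by_contra h
      exact hy (hf h)
    simp [this]

theorem _root_.HahnSeries.coeff_mul_eq_finsum {Γ R : Type*} [AddCommGroup Γ] [PartialOrder Γ]
    [IsOrderedCancelAddMonoid Γ] [Semiring R] (f g : HahnSeries Γ R) (c : Γ) :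
    (f * g).coeff c = ∑ᶠ a, f.coeff a * g.coeff (c - a) := by
  classical
  rw [HahnSeries.coeff_mul, finsum_eq_sum_of_support_subset (s := (Finset.antidiagonal
    f.isPWO_support g.isPWO_support c).image Prod.fst), Finset.sum_image]
  · refine Finset.sum_congr rfl fun x hx => ?_
    rw [Finset.mem_antidiagonal] at hx
    rw [← hx.2.2, add_sub_cancel_left]
  · rintro ⟨a, b⟩ hx ⟨a', b'⟩ hy h
    rw [Finset.mem_coe, Finset.mem_antidiagonal] at hx hy
    simp only at h hx hy
    subst h
    rw [add_left_cancel (hx.2.2.trans hy.2.2.symm)]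
  · intro a ha
    rw [Finset.coe_image]
    refine ⟨(a, c - a), ?_, rfl⟩
    rw [Finset.mem_coe, Finset.mem_antidiagonal]
    exact ⟨left_ne_zero_of_mul ha, right_ne_zero_of_mul ha, add_sub_cancel a c⟩

/-- The coefficient of `x^b` in the `g`-th derivative of `x^(b + g)`. -/
def derivWeight (b : ℤ) (g : ℕ) : ℤ := Ring.choose (b + g) g * g.factorial

theorem derivWeight_succ (b : ℤ) (g : ℕ) :
    derivWeight b (g + 1) = (b + 1) * derivWeight (b + 1) g := by
  have h := choose_mul_choose_sub (b + 1 + g) g 1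
  rw [Ring.choose_one_right, add_sub_cancel_right] at h
  have h2 : (g + 1).choose g = g + 1 := Nat.choose_succ_self_right g
  rw [h2] at h
  unfold derivWeight
  rw [Nat.factorial_succ, show b + ((g + 1 : ℕ) : ℤ) = b + 1 + g by push_cast; ring]
  push_cast at h ⊢
  linear_combination -(g.factorial : ℤ) * h

theorem coeff_partialDeriv_pow (i : Fin n) (g : ℕ) (f : IterLaurent n k) (s : Expo n) :
    ((partialDeriv i ^ g) f).coeff s =
      (derivWeight (s i) g : k) * f.coeff (s + toColex (Pi.single i (g : ℤ))) := by
  induction g generalizing s with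
  | zero => simp [derivWeight]
  | succ g ih =>
    rw [pow_succ']
    change ((s i + 1 : ℤ) : k) *
      ((partialDeriv i ^ g) f).coeff (s + toColex (Pi.single i 1)) = _
    have h1 : (s + toColex (Pi.single i 1) : Expo n) i = s i + 1 := by
      change s i + (Pi.single i 1 : Fin n → ℤ) i = _
      rw [Pi.single_eq_same]
    rw [ih, h1, derivWeight_succ, add_assoc, ← toColex_add, ← Pi.single_add,
      add_comm (1 : ℤ)]
    push_cast
    ring

/-- The indices must be distinct: the shift caused by differentiating in `xᵢ` then leaves the
exponents that enter the other factors unchanged. -/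
theorem coeff_list_prod_partialDeriv (γ : Fin n → ℕ) (l : List (Fin n)) (hl : l.Nodup)
    (f : IterLaurent n k) (s : Expo n) :
    ((l.map fun i => partialDeriv i ^ γ i).prod f).coeff s =
      (l.map fun i => (derivWeight (s i) (γ i) : k)).prod *
        f.coeff (s + toColex (l.map fun i => (Pi.single i (γ i : ℤ) : Fin n → ℤ)).sum) := by
  induction l generalizing s with
  | nil => simp
  | cons i l ih =>
    rw [List.nodup_cons] at hl
    rw [List.map_cons, List.prod_cons, Module.End.mul_apply, coeff_partialDeriv_pow,
      ih hl.2]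
    have h : (l.map fun j => (derivWeight ((s + toColex (Pi.single i (γ i : ℤ)) : Expo n) j)
        (γ j) : k)) = l.map fun j => (derivWeight (s j) (γ j) : k) := by
      refine List.map_congr_left fun j hj => ?_
      have hji : j ≠ i := fun h => hl.1 (h ▸ hj)
      have : (s + toColex (Pi.single i (γ i : ℤ)) : Expo n) j = s j := by
        change s j + (Pi.single i (γ i : ℤ) : Fin n → ℤ) j = _
        rw [Pi.single_eq_of_ne hji, add_zero]
      rw [this]
    rw [h, List.map_cons, List.prod_cons, List.map_cons, List.sum_cons, toColex_add, add_assoc,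
      mul_assoc]

theorem coeff_iterDeriv (γ : Fin n → ℕ) (f : IterLaurent n k) (b : Fin n → ℤ) :
    (iterDeriv γ f).coeff (toColex b) =
      (∏ i, (derivWeight (b i) (γ i) : k)) * f.coeff (toColex fun i => b i + γ i) := by
  rw [iterDeriv, List.ofFn_eq_map, coeff_list_prod_partialDeriv _ _ (List.nodup_finRange n),
    ← Fin.prod_univ_def, ← Fin.sum_univ_def, Finset.univ_sum_single, ← toColex_add]
  rfl

theorem coeff_mulTerm (L M : PsiDO n k) (c δ : Fin n → ℤ) (q : (Fin n → ℤ) × (Fin n → ℕ)) :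
    (mulTerm L M δ q).coeff (toColex c) =
      ∑ᶠ a : Fin n → ℤ, (multiWeight (a, q.1) ((c, δ) + diag q.2 - (a, q.1)) q.2 : k) *
        (cf L (a, q.1) * cf M ((c, δ) + diag q.2 - (a, q.1))) := by
  obtain ⟨α, γ⟩ := q
  rw [mulTerm, HahnSeries.coeff_smul, HahnSeries.coeff_mul_eq_finsum, ← Int.cast_smul_eq_zsmul k,
    smul_eq_mul, mul_finsum]
  rw [← finsum_comp_equiv (toColex : (Fin n → ℤ) ≃ _)]
  refine finsum_congr fun a => ?_
  have h1 : (iterDeriv γ (M.coeff fun i => δ i - α i + γ i)).coeff (toColex c - toColex a) =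
      (∏ i, (derivWeight (c i - a i) (γ i) : k)) * cf M ((c, δ) + diag γ - (a, α)) := by
    rw [← toColex_sub, coeff_iterDeriv]
    congr 1
    rw [cf]
    congr 2
    · funext i
      simp only [diag, Prod.snd_sub, Prod.snd_add, Pi.sub_apply, Pi.add_apply]
      ring
    · funext i
      simp only [diag, Prod.fst_sub, Prod.fst_add, Pi.sub_apply, Pi.add_apply]
      ring
  simp only
  rw [h1]
  have h2 : (multiWeight (a, α) ((c, δ) + diag γ - (a, α)) γ : k) =
      ((∏ i, Ring.choose (α i) (γ i) : ℤ) : k) * ∏ i, (derivWeight (c i - a i) (γ i) : k) := by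
    rw [multiWeight, ← Int.cast_prod, ← Int.cast_mul, ← Finset.prod_mul_distrib]
    congr 1
    refine Finset.prod_congr rfl fun i _ => ?_
    rw [weight, derivWeight]
    congr 3
    simp only [diag, Prod.fst_sub, Prod.fst_add, Pi.sub_apply, Pi.add_apply]
    ring
  have h3 : HahnSeries.coeff (L.coeff α) (toColex a) = cf L (a, α) := rfl
  rw [h2, h3]
  ring

theorem support_mul_subset (f g : Bideg n → k) (w : Bideg n × Bideg n × (Fin n → ℕ) → k)
    (e : Bideg n) :
    (Function.support fun z : Bideg n × Bideg n × (Fin n → ℕ) =>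
      open Classical in if z.1 + z.2.1 - diag z.2.2 = e then w z * (f z.1 * g z.2.1) else 0) ⊆
      {z | z.1 ∈ Function.support f ∧ z.2.1 ∈ Function.support g ∧
        z.1 + z.2.1 - diag z.2.2 = e} := by
  intro z hz
  rw [Function.mem_support, ne_eq, ite_eq_right_iff, Classical.not_imp] at hz
  exact ⟨left_ne_zero_of_mul (right_ne_zero_of_mul hz.2),
    right_ne_zero_of_mul (right_ne_zero_of_mul hz.2), hz.1⟩

/-- The Leibniz rule as one sum over pairs of monomials and numbers `γ` of derivatives.
Associativity, the trace property and the pairing are all read off from this form. -/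
theorem cf_mul (L M : PsiDO n k) (e : Bideg n) :
    cf (L * M) e = ∑ᶠ z : Bideg n × Bideg n × (Fin n → ℕ),
      open Classical in if z.1 + z.2.1 - diag z.2.2 = e then
        (multiWeight z.1 z.2.1 z.2.2 : k) * (cf L z.1 * cf M z.2.1) else 0 := by
  classical
  obtain ⟨c, δ⟩ := e
  have h1 : cf (L * M) (c, δ) = ∑ᶠ q, (mulTerm L M δ q).coeff (toColex c) := by
    change HahnSeries.coeff (∑ᶠ q, mulTerm L M (-(-δ)) q) (toColex c) = _
    rw [neg_neg]
    exact (AddMonoidHom.mk' (fun f : IterLaurent n k => f.coeff (toColex c))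
      fun _ _ => rfl).map_finsum (finite_mulTerm L M δ)
  -- With `α`, `γ` and the target bidegree fixed, only the exponent `a` of `x` in the left factor
  -- remains free.
  rw [h1, finsum_fiberwise (fun z : Bideg n × Bideg n × (Fin n → ℕ) => (z.1.2, z.2.2))]
  · refine finsum_congr fun q => ?_
    rw [coeff_mulTerm]
    obtain ⟨α, γ⟩ := q
    rw [finsum_eq_finsum_comp
      (fun a : Fin n → ℤ => ((a, α), (c, δ) + diag γ - (a, α), γ))]
    · refine finsum_congr fun a => ?_
      simp
    · intro a b h
      simpa using congrArg (fun z => z.1.1) h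
    · rintro ⟨⟨a, α'⟩, q, γ'⟩ hz
      simp only [Function.mem_support, ne_eq, ite_eq_right_iff, Classical.not_imp,
        Prod.mk.injEq] at hz
      obtain ⟨⟨rfl, rfl⟩, h2, -⟩ := hz
      refine ⟨a, ?_⟩
      simp only [← h2]
      congr
      abel
  · exact ((isSmall_support_cf L).finite_add_sub_diag (isSmall_support_cf M) _).subset
      (support_mul_subset _ _ (fun z => (multiWeight z.1 z.2.1 z.2.2 : k)) _)

/-! ### Expansions and the ring structure -/

/-- `L = ∑ φ_j x^a ∂^α`, where `(a, α) = e j`. -/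
structure IsExpansion {J : Type*} (φ : J → k) (e : J → Bideg n) (L : PsiDO n k) : Prop where
  small : IsSmall (e '' Function.support φ)
  finite : ∀ p, {j | φ j ≠ 0 ∧ e j = p}.Finite
  cf_eq : ∀ p, cf L p = ∑ᶠ j, open Classical in if e j = p then φ j else 0

theorem isExpansion_cf (L : PsiDO n k) : IsExpansion (cf L) id L where
  small := by simpa using isSmall_support_cf L
  finite p := (Set.finite_singleton p).subset fun j hj => hj.2
  cf_eq p := by
    classical
    rw [finsum_eq_single _ p fun q hq => if_neg (by simpa using hq)]
    simp

/-- Since `e` may repeat bidegrees, like terms need not be collected before multiplying again. This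
serves triple products, and later expansions whose terms are monomials in the coordinates. -/
theorem IsExpansion.mul {J J' : Type*} {φ : J → k} {e : J → Bideg n} {φ' : J' → k}
    {e' : J' → Bideg n} {L M : PsiDO n k} (h : IsExpansion φ e L) (h' : IsExpansion φ' e' M) :
    IsExpansion (J := J × J' × (Fin n → ℕ))
      (fun z => (multiWeight (e z.1) (e' z.2.1) z.2.2 : k) * (φ z.1 * φ' z.2.1))
      (fun z => e z.1 + e' z.2.1 - diag z.2.2) (L * M) := by
  classical
  have hfin : ∀ p, {z : J × J' × (Fin n → ℕ) |
      (multiWeight (e z.1) (e' z.2.1) z.2.2 : k) * (φ z.1 * φ' z.2.1) ≠ 0 ∧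
        e z.1 + e' z.2.1 - diag z.2.2 = p}.Finite := by
    intro p
    refine ((h.small.finite_add_sub_diag h'.small p).biUnion
      (t := fun y => {j | φ j ≠ 0 ∧ e j = y.1} ×ˢ ({j | φ' j ≠ 0 ∧ e' j = y.2.1} ×ˢ {y.2.2}))
      fun y _ => (h.finite _).prod ((h'.finite _).prod (Set.finite_singleton _))).subset ?_
    rintro ⟨j, j', γ⟩ ⟨hz, hp⟩
    have h1 := left_ne_zero_of_mul (right_ne_zero_of_mul hz)
    have h2 := right_ne_zero_of_mul (right_ne_zero_of_mul hz)
    refine Set.mem_biUnion (x := (e j, e' j', γ)) ⟨⟨j, h1, rfl⟩, ⟨j', h2, rfl⟩, hp⟩ ?_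
    exact ⟨⟨h1, rfl⟩, ⟨h2, rfl⟩, rfl⟩
  refine ⟨(h.small.add_sub_diag h'.small).mono ?_, hfin, fun p => ?_⟩
  · rintro _ ⟨⟨j, j', γ⟩, hz, rfl⟩
    exact ⟨_, ⟨j, left_ne_zero_of_mul (right_ne_zero_of_mul hz), rfl⟩, _,
      ⟨j', right_ne_zero_of_mul (right_ne_zero_of_mul hz), rfl⟩, γ, rfl⟩
  · rw [cf_mul, finsum_fiberwise
      (fun z : J × J' × (Fin n → ℕ) => (e z.1, e' z.2.1, z.2.2)) (fun z => ite _ _ _)]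
    · refine finsum_congr fun y => ?_
      obtain ⟨q, r, γ⟩ := y
      rw [finsum_eq_finsum_comp (fun z : J × J' => (z.1, z.2, γ))]
      · simp only [Prod.mk.injEq, and_true]
        rw [h.cf_eq, h'.cf_eq, finsum_mul_finsum, mul_finsum]
        · split_ifs with hc
          · refine finsum_congr fun z => ?_
            by_cases h1 : e z.1 = q
            · by_cases h2 : e' z.2 = r
              · simp [h1, h2, hc]
              · simp [h2]
            · simp [h1]
          · rw [finsum_eq_zero_of_forall_eq_zero]
            intro z
            by_cases h1 : e z.1 = q ∧ e' z.2 = r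
            · rw [if_pos h1, h1.1, h1.2, if_neg hc]
            · rw [if_neg h1]
        · refine (h.finite q).subset fun j hj => ?_
          rw [Function.mem_support, ne_eq, ite_eq_right_iff, Classical.not_imp] at hj
          exact ⟨hj.2, hj.1⟩
        · refine (h'.finite r).subset fun j hj => ?_
          rw [Function.mem_support, ne_eq, ite_eq_right_iff, Classical.not_imp] at hj
          exact ⟨hj.2, hj.1⟩
      · rintro ⟨a, b⟩ ⟨a', b'⟩ hab
        simpa using hab
      · rintro ⟨j, j', γ'⟩ hz
        simp only [Function.mem_support, ne_eq, ite_eq_right_iff, Classical.not_imp,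
          Prod.mk.injEq] at hz
        exact ⟨(j, j'), by rw [hz.1.2.2]⟩
    · refine (hfin p).subset fun j hj => ?_
      rw [Function.mem_support, ne_eq, ite_eq_right_iff, Classical.not_imp] at hj
      exact ⟨hj.2, hj.1⟩

/-- The pairs `(γ, γ')` with `γ + γ' = Γ`, coordinatewise. -/
def splittings (Γ : Fin n → ℕ) : Finset (Fin n → ℕ × ℕ) :=
  Fintype.piFinset fun i => Finset.HasAntidiagonal.antidiagonal (Γ i)

theorem mem_splittings {Γ : Fin n → ℕ} {δ : Fin n → ℕ × ℕ} :
    δ ∈ splittings Γ ↔ ((fun i => (δ i).1) + fun i => (δ i).2) = Γ := by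
  simp [splittings, Fintype.mem_piFinset, funext_iff]

theorem sum_multiWeight_assoc (p q r : Bideg n) (Γ : Fin n → ℕ) :
    ∑ δ ∈ splittings Γ, multiWeight p q (fun i => (δ i).1) *
        multiWeight (p + q - diag fun i => (δ i).1) r (fun i => (δ i).2) =
      ∑ δ ∈ splittings Γ, multiWeight q r (fun i => (δ i).1) *
        multiWeight p (q + r - diag fun i => (δ i).1) (fun i => (δ i).2) := by
  simp only [multiWeight, ← Finset.prod_mul_distrib]
  refine (Finset.prod_univ_sum _ fun i (y : ℕ × ℕ) => weight (p.2 i) (q.1 i) y.1 *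
      weight (p.2 i + q.2 i - y.1) (r.1 i) y.2).symm.trans (Eq.trans ?_
    (Finset.prod_univ_sum _ fun i (y : ℕ × ℕ) => weight (q.2 i) (r.1 i) y.1 *
      weight (p.2 i) (q.1 i + r.1 i - y.1) y.2))
  exact Finset.prod_congr rfl fun i _ => weight_assoc _ _ _ _ _

theorem finsum_ite_add_eq_sum {A : Type*} [AddCommMonoid A] (Γ : Fin n → ℕ)
    (F : (Fin n → ℕ) → (Fin n → ℕ) → A) :
    ∑ᶠ z : (Fin n → ℕ) × (Fin n → ℕ), (if z.1 + z.2 = Γ then F z.1 z.2 else 0) =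
      ∑ δ ∈ splittings Γ, F (fun i => (δ i).1) (fun i => (δ i).2) := by
  rw [← finsum_comp_equiv (Equiv.arrowProdEquivProdArrow (Fin n) (fun _ => ℕ) (fun _ => ℕ))]
  rw [finsum_eq_sum_of_support_subset (s := splittings Γ)]
  · refine Finset.sum_congr rfl fun δ hδ => ?_
    exact if_pos (mem_splittings.mp hδ)
  · intro δ hδ
    rw [Function.mem_support, ne_eq, ite_eq_right_iff, Classical.not_imp] at hδ
    exact mem_splittings.mpr hδ.1

/-- Both triple products are grouped by the three monomials and the total `Γ` of derivatives taken
in the two multiplications. The sums over splittings of `Γ` agree by `sum_multiWeight_assoc`. -/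
theorem mul_assoc' (L M N : PsiDO n k) : L * M * N = L * (M * N) := by
  classical
  apply cf_injective
  funext s
  have E1 := ((isExpansion_cf L).mul (isExpansion_cf M)).mul (isExpansion_cf N)
  have E2 := (isExpansion_cf L).mul ((isExpansion_cf M).mul (isExpansion_cf N))
  let Y := Bideg n × Bideg n × Bideg n × (Fin n → ℕ)
  let t : Y → k := fun y => if y.1 + y.2.1 + y.2.2.1 - diag y.2.2.2 = s then
    cf L y.1 * cf M y.2.1 * cf N y.2.2.1 else 0
  have key1 : cf (L * M * N) s = ∑ᶠ y : Y, t y *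
      ((∑ δ ∈ splittings y.2.2.2, multiWeight y.1 y.2.1 (fun i => (δ i).1) *
        multiWeight (y.1 + y.2.1 - diag fun i => (δ i).1) y.2.2.1 (fun i => (δ i).2) : ℤ) : k) := by
    rw [E1.cf_eq, finsum_fiberwise (fun x : (Bideg n × Bideg n × (Fin n → ℕ)) × Bideg n ×
      (Fin n → ℕ) => ((x.1.1, x.1.2.1, x.2.1, x.1.2.2 + x.2.2) : Y)) (fun z => ite _ _ _)]
    · refine finsum_congr fun y => ?_
      obtain ⟨p, q, r, Γ⟩ := y
      rw [finsum_eq_finsum_comp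
        (fun z : (Fin n → ℕ) × (Fin n → ℕ) => ((p, q, z.1), r, z.2))]
      · push_cast
        rw [← finsum_ite_add_eq_sum Γ fun γ γ' => (multiWeight p q γ : k) *
          multiWeight (p + q - diag γ) r γ', mul_finsum]
        refine finsum_congr fun z => ?_
        simp only [Prod.mk.injEq, true_and, id, t]
        by_cases hz : z.1 + z.2 = Γ
        · have : p + q - diag z.1 + r - diag z.2 = p + q + r - diag Γ := by
            rw [← hz, diag_add]; abel
          rw [if_pos hz, if_pos hz, this]
          split_ifs <;> ring
        · rw [if_neg hz, if_neg hz, mul_zero]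
      · rintro ⟨a, b⟩ ⟨a', b'⟩ hab
        simpa using hab
      · rintro ⟨⟨p', q', γ⟩, r', γ'⟩ hz
        simp only [Function.mem_support, ne_eq, ite_eq_right_iff, Classical.not_imp,
          Prod.mk.injEq] at hz
        exact ⟨(γ, γ'), by rw [hz.1.1, hz.1.2.1, hz.1.2.2.1]⟩
    · refine (E1.finite s).subset fun j hj => ?_
      rw [Function.mem_support, ne_eq, ite_eq_right_iff, Classical.not_imp] at hj
      exact ⟨hj.2, hj.1⟩
  have key2 : cf (L * (M * N)) s = ∑ᶠ y : Y, t y *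
      ((∑ δ ∈ splittings y.2.2.2, multiWeight y.2.1 y.2.2.1 (fun i => (δ i).1) *
        multiWeight y.1 (y.2.1 + y.2.2.1 - diag fun i => (δ i).1)
          (fun i => (δ i).2) : ℤ) : k) := by
    rw [E2.cf_eq, finsum_fiberwise (fun x : Bideg n × (Bideg n × Bideg n × (Fin n → ℕ)) ×
      (Fin n → ℕ) => ((x.1, x.2.1.1, x.2.1.2.1, x.2.1.2.2 + x.2.2) : Y)) (fun z => ite _ _ _)]
    · refine finsum_congr fun y => ?_
      obtain ⟨p, q, r, Γ⟩ := y
      rw [finsum_eq_finsum_comp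
        (fun z : (Fin n → ℕ) × (Fin n → ℕ) => (p, (q, r, z.1), z.2))]
      · push_cast
        rw [← finsum_ite_add_eq_sum Γ fun γ γ' => (multiWeight q r γ : k) *
          multiWeight p (q + r - diag γ) γ', mul_finsum]
        refine finsum_congr fun z => ?_
        simp only [Prod.mk.injEq, true_and, id, t]
        by_cases hz : z.1 + z.2 = Γ
        · have : p + (q + r - diag z.1) - diag z.2 = p + q + r - diag Γ := by
            rw [← hz, diag_add]; abel
          rw [if_pos hz, if_pos hz, this]
          split_ifs <;> ring
        · rw [if_neg hz, if_neg hz, mul_zero]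
      · rintro ⟨a, b⟩ ⟨a', b'⟩ hab
        simpa using hab
      · rintro ⟨p', ⟨q', r', γ⟩, γ'⟩ hz
        simp only [Function.mem_support, ne_eq, ite_eq_right_iff, Classical.not_imp,
          Prod.mk.injEq] at hz
        exact ⟨(γ, γ'), by rw [hz.1.1, hz.1.2.1, hz.1.2.2.1]⟩
    · refine (E2.finite s).subset fun j hj => ?_
      rw [Function.mem_support, ne_eq, ite_eq_right_iff, Classical.not_imp] at hj
      exact ⟨hj.2, hj.1⟩
  rw [key1, key2]
  simp only [sum_multiWeight_assoc]

theorem finite_support_cf_mul (L M : PsiDO n k) (e : Bideg n) :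
    (Function.support fun z : Bideg n × Bideg n × (Fin n → ℕ) =>
      open Classical in if z.1 + z.2.1 - diag z.2.2 = e then
        (multiWeight z.1 z.2.1 z.2.2 : k) * (cf L z.1 * cf M z.2.1) else 0).Finite :=
  ((isSmall_support_cf L).finite_add_sub_diag (isSmall_support_cf M) _).subset
    (support_mul_subset _ _ (fun z => (multiWeight z.1 z.2.1 z.2.2 : k)) _)

theorem add_mul' (L M N : PsiDO n k) : (L + M) * N = L * N + M * N := by
  apply cf_injective
  funext s
  rw [cf_add, Pi.add_apply, cf_mul, cf_mul, cf_mul,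
    ← finsum_add_distrib (finite_support_cf_mul L N s) (finite_support_cf_mul M N s)]
  refine finsum_congr fun z => ?_
  split_ifs
  · rw [cf_add, Pi.add_apply]; ring
  · rw [add_zero]

theorem mul_add' (L M N : PsiDO n k) : L * (M + N) = L * M + L * N := by
  apply cf_injective
  funext s
  rw [cf_add, Pi.add_apply, cf_mul, cf_mul, cf_mul,
    ← finsum_add_distrib (finite_support_cf_mul L M s) (finite_support_cf_mul L N s)]
  refine finsum_congr fun z => ?_
  split_ifs
  · rw [cf_add, Pi.add_apply]; ring
  · rw [add_zero]

theorem smul_mul' (c : k) (L M : PsiDO n k) : (c • L) * M = c • (L * M) := by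
  apply cf_injective
  funext s
  rw [cf_smul, Pi.smul_apply, cf_mul, cf_mul, smul_finsum]
  refine finsum_congr fun z => ?_
  rw [cf_smul, Pi.smul_apply]
  split_ifs
  · simp only [smul_eq_mul]; ring
  · simp

theorem mul_smul' (c : k) (L M : PsiDO n k) : L * (c • M) = c • (L * M) := by
  apply cf_injective
  funext s
  rw [cf_smul, Pi.smul_apply, cf_mul, cf_mul, smul_finsum]
  refine finsum_congr fun z => ?_
  rw [cf_smul, Pi.smul_apply]
  split_ifs
  · simp only [smul_eq_mul]; ring
  · simp

theorem multiWeight_zero (p q : Bideg n) : multiWeight p q 0 = 1 := by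
  simp [multiWeight, weight_zero]

theorem weight_eq_zero_left (b : ℤ) {g : ℕ} (h : g ≠ 0) : weight 0 b g = 0 := by
  obtain ⟨g, rfl⟩ := Nat.exists_eq_succ_of_ne_zero h
  simp [weight, Ring.choose_zero_succ]

theorem weight_eq_zero_right (α : ℤ) {g : ℕ} (h : g ≠ 0) : weight α 0 g = 0 := by
  obtain ⟨g, rfl⟩ := Nat.exists_eq_succ_of_ne_zero h
  simp [weight, Ring.choose_zero_succ]

theorem one_mul' (L : PsiDO n k) : 1 * L = L := by
  apply cf_injective
  funext s
  rw [cf_mul, finsum_eq_single _ (0, s, 0)]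
  · simp [multiWeight_zero, cf_one, diag_zero]
  · rintro ⟨p, q, γ⟩ hne
    rw [ite_eq_right_iff]
    intro h
    rw [cf_one]
    simp only at h ⊢
    split_ifs with hp
    · by_cases hγ : γ = 0
      · subst hp hγ
        refine absurd ?_ hne
        rw [zero_add, diag_zero, sub_zero] at h
        rw [h]
      · obtain ⟨i, hi⟩ := Function.ne_iff.mp hγ
        rw [multiWeight, Finset.prod_eq_zero (Finset.mem_univ i), Int.cast_zero, zero_mul]
        rw [hp]
        exact weight_eq_zero_left _ hi
    · ring

theorem mul_one' (L : PsiDO n k) : L * 1 = L := by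
  apply cf_injective
  funext s
  rw [cf_mul, finsum_eq_single _ (s, 0, 0)]
  · simp [multiWeight_zero, cf_one, diag_zero]
  · rintro ⟨p, q, γ⟩ hne
    rw [ite_eq_right_iff]
    intro h
    rw [cf_one]
    simp only at h ⊢
    split_ifs with hp
    · by_cases hγ : γ = 0
      · subst hp hγ
        refine absurd ?_ hne
        rw [add_zero, diag_zero, sub_zero] at h
        rw [h]
      · obtain ⟨i, hi⟩ := Function.ne_iff.mp hγ
        rw [multiWeight, Finset.prod_eq_zero (Finset.mem_univ i), Int.cast_zero, zero_mul]
        rw [hp]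
        exact weight_eq_zero_right _ hi
    · ring

noncomputable instance : Ring (PsiDO n k) :=
  { (inferInstance : AddCommGroup (PsiDO n k)) with
    mul := (· * ·)
    one := 1
    mul_assoc := mul_assoc'
    left_distrib := mul_add'
    right_distrib := add_mul'
    one_mul := one_mul'
    mul_one := mul_one'
    zero_mul := fun L => by
      have h := smul_mul' (0 : k) (0 : PsiDO n k) L
      rwa [zero_smul, zero_smul] at h
    mul_zero := fun L => by
      have h := mul_smul' (0 : k) L (0 : PsiDO n k)
      rwa [zero_smul, zero_smul] at h }

noncomputable instance : Algebra k (PsiDO n k) :=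
  Algebra.ofModule smul_mul' mul_smul'

/-! ### The trace property and duality for the residue pairing -/

theorem multiWeight_reflect {p q : Bideg n} {γ : Fin n → ℕ} (h : p + q - diag γ = -1) :
    multiWeight p q γ = multiWeight q p γ := by
  refine Finset.prod_congr rfl fun i _ => ?_
  have h1 := congrFun (congrArg Prod.fst h) i
  have h2 := congrFun (congrArg Prod.snd h) i
  simp only [diag, Prod.fst_sub, Prod.fst_add, Prod.snd_sub, Prod.snd_add, Pi.sub_apply,
    Pi.add_apply, Prod.fst_neg, Prod.snd_neg, Prod.fst_one, Prod.snd_one, Pi.neg_apply,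
    Pi.one_apply] at h1 h2
  rw [show q.1 i = (γ i : ℤ) - 1 - p.1 i by linarith, weight_reflect,
    show q.2 i = (γ i : ℤ) - 1 - p.2 i by linarith]

/-- The residue is a trace. -/
theorem residue_mul_comm (L M : PsiDO n k) : residue (L * M) = residue (M * L) := by
  classical
  let e : Bideg n × Bideg n × (Fin n → ℕ) ≃ Bideg n × Bideg n × (Fin n → ℕ) :=
    ⟨fun z => (z.2.1, z.1, z.2.2), fun z => (z.2.1, z.1, z.2.2), fun _ => rfl, fun _ => rfl⟩
  rw [residue_eq_cf, residue_eq_cf, cf_mul, cf_mul, ← finsum_comp_equiv e]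
  refine finsum_congr fun z => ?_
  simp only [e, Equiv.coe_fn_mk]
  rw [add_comm z.2.1 z.1]
  split_ifs with h
  · rw [multiWeight_reflect h, mul_comm (cf M z.1)]
  · rfl

/-- The coefficients of the operator `exp(ε ∑ ∂²/∂x_i ∂ξ_i)` on symbols. -/
def twistWeight (ε : ℤ) (b : Bideg n) (γ : Fin n → ℕ) : ℤ :=
  ∏ i, ε ^ γ i * weight (b.2 i + γ i) (b.1 i + γ i) (γ i)

/-- The operator `exp(ε ∑ ∂²/∂x_i ∂ξ_i)` on symbols. -/
noncomputable def twist (ε : ℤ) (u : Bideg n → k) (b : Bideg n) : k :=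
  ∑ᶠ γ, (twistWeight ε b γ : k) * u (b + diag γ)

theorem finite_add_diag (u : Bideg n → k) (hu : IsSmall (Function.support u)) (b : Bideg n) :
    {γ | u (b + diag γ) ≠ 0}.Finite := by
  refine ((hu.finite_add_sub_diag (Set.finite_singleton 0).isSmall b).image
    fun z => z.2.2).subset fun γ hγ => ?_
  exact ⟨(b + diag γ, 0, γ), ⟨hγ, rfl, by simp⟩, rfl⟩

theorem isSmall_support_twist (ε : ℤ) (u : Bideg n → k) (hu : IsSmall (Function.support u)) :
    IsSmall (Function.support (twist ε u)) := by
  refine (hu.add_sub_diag (Set.finite_singleton 0).isSmall).mono fun b hb => ?_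
  obtain ⟨γ, hγ⟩ : ∃ γ, (twistWeight ε b γ : k) * u (b + diag γ) ≠ 0 := by
    by_contra h
    exact hb (finsum_eq_zero_of_forall_eq_zero fun q => not_not.mp (not_exists.mp h q))
  exact ⟨b + diag γ, right_ne_zero_of_mul hγ, 0, rfl, γ, by simp⟩

theorem sum_twistWeight (ε : ℤ) (b : Bideg n) (Γ : Fin n → ℕ) :
    ∑ δ ∈ splittings Γ, twistWeight ε b (fun i => (δ i).1) *
      twistWeight (-ε) (b + diag fun i => (δ i).1) (fun i => (δ i).2) =
        if Γ = 0 then 1 else 0 := by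
  let F : Fin n → ℕ × ℕ → ℤ := fun i x =>
    (ε ^ x.1 * weight (b.2 i + x.1) (b.1 i + x.1) x.1) *
      ((-ε) ^ x.2 * weight (b.2 i + Γ i) (b.1 i + Γ i) x.2)
  have h1 : ∀ δ ∈ splittings Γ, twistWeight ε b (fun i => (δ i).1) *
      twistWeight (-ε) (b + diag fun i => (δ i).1) (fun i => (δ i).2) = ∏ i, F i (δ i) := by
    intro δ hδ
    rw [twistWeight, twistWeight, ← Finset.prod_mul_distrib]
    refine Finset.prod_congr rfl fun i _ => ?_
    have hi : (δ i).1 + (δ i).2 = Γ i := congrFun (mem_splittings.mp hδ) i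
    simp only [F, diag, Prod.snd_add, Prod.fst_add, Pi.add_apply]
    rw [← hi]
    push_cast
    simp only [add_assoc]
  rw [Finset.sum_congr rfl h1, splittings, ← Finset.prod_univ_sum]
  have h2 : ∀ i, ∑ x ∈ Finset.HasAntidiagonal.antidiagonal (Γ i), F i x =
      if Γ i = 0 then 1 else 0 := fun i => sum_weight_inverse ε (b.1 i) (b.2 i) (Γ i)
  simp only [h2]
  split_ifs with h
  · subst h; simp
  · obtain ⟨i, hi⟩ := Function.ne_iff.mp h
    exact Finset.prod_eq_zero (Finset.mem_univ i) (if_neg hi)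

theorem twist_twist (ε : ℤ) (u : Bideg n → k) (hu : IsSmall (Function.support u)) :
    twist ε (twist (-ε) u) = u := by
  classical
  funext b
  let f : (Fin n → ℕ) × (Fin n → ℕ) → k := fun z =>
    (twistWeight ε b z.1 : k) * ((twistWeight (-ε) (b + diag z.1) z.2 : k) *
      u (b + diag z.1 + diag z.2))
  have hf : (Function.support f).Finite := by
    -- A nonzero term has `γ + γ'` in a finite set, and each total has finitely many splittings.
    refine ((finite_add_diag u hu b).biUnion
      (t := fun Γ => Set.Icc 0 Γ ×ˢ Set.Icc 0 Γ)
      fun Γ _ => (Set.finite_Icc _ _).prod (Set.finite_Icc _ _)).subset ?_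
    rintro ⟨γ, γ'⟩ hz
    have h1 := right_ne_zero_of_mul (right_ne_zero_of_mul hz)
    refine Set.mem_biUnion (x := γ + γ') ?_ ⟨⟨fun i => Nat.zero_le _, fun i => Nat.le_add_right _ _⟩,
      ⟨fun i => Nat.zero_le _, fun i => Nat.le_add_left _ _⟩⟩
    rw [Set.mem_ofPred_eq, diag_add, ← add_assoc]
    exact h1
  have h1 : twist ε (twist (-ε) u) b = ∑ᶠ z, f z := by
    rw [finsum_curry _ hf]
    refine finsum_congr fun γ => ?_
    rw [twist, mul_finsum]
  rw [h1, finsum_fiberwise (fun z => z.1 + z.2) f hf]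
  have h2 : ∀ Γ : Fin n → ℕ, ∑ᶠ z : (Fin n → ℕ) × (Fin n → ℕ),
      (if z.1 + z.2 = Γ then f z else 0) = (if Γ = 0 then 1 else 0) * u (b + diag Γ) := by
    intro Γ
    rw [finsum_ite_add_eq_sum Γ fun γ γ' => f (γ, γ')]
    have : (if Γ = 0 then 1 else 0 : k) = ((if Γ = 0 then 1 else 0 : ℤ) : k) := by
      split_ifs <;> simp
    rw [this, ← sum_twistWeight ε b Γ, Int.cast_sum, Finset.sum_mul]
    refine Finset.sum_congr rfl fun δ hδ => ?_
    rw [← mem_splittings.mp hδ, diag_add]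
    simp only [f]
    push_cast
    rw [add_assoc, mul_assoc]
  refine (finsum_congr fun Γ => (finsum_congr fun z => ?_).trans (h2 Γ)).trans ?_
  · congr
  rw [finsum_eq_single _ 0 fun Γ hΓ => by rw [if_neg hΓ, zero_mul]]
  simp [diag_zero]

/-- For a fixed monomial of `M`, the residue condition leaves only `γ` free in `U`, and
`weight_neg_one_sub` identifies the weights with those of the twist by `-1`. -/
theorem residue_mul_eq (M U : PsiDO n k) :
    residue (M * U) = ∑ᶠ p, cf M p * twist (-1) (cf U) (-1 - p) := by
  classical
  have hpd : ∀ a p d : Bideg n, p + (a - p + d) - d = a := fun a p d => by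
    rw [← add_assoc, add_sub_cancel, add_sub_cancel_right]
  rw [residue_eq_cf, cf_mul, finsum_fiberwise (fun z => z.1) _ (finite_support_cf_mul M U _)]
  refine finsum_congr fun p => ?_
  rw [finsum_eq_finsum_comp (fun γ : Fin n → ℕ => (p, -1 - p + diag γ, γ))]
  · rw [twist, mul_finsum]
    refine finsum_congr fun γ => ?_
    have h : multiWeight p (-1 - p + diag γ) γ = twistWeight (-1) (-1 - p) γ := by
      refine Finset.prod_congr rfl fun i _ => ?_
      rw [← weight_neg_one_sub]
      simp [diag]
    rw [if_pos rfl, if_pos (hpd _ _ _), ← h]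
    ring
  · intro γ γ' h
    simpa using congrArg (fun z => z.2.2) h
  · rintro ⟨p', q, γ⟩ hz
    simp only [Function.mem_support, ne_eq, ite_eq_right_iff, Classical.not_imp] at hz
    obtain ⟨rfl, h2, -⟩ := hz
    refine ⟨γ, ?_⟩
    simp only [← h2]
    congr
    abel

theorem exists_cf_single (p : Bideg n) : ∃ M : PsiDO n k, cf M = Pi.single p 1 :=
  exists_cf_eq _ ((Set.finite_singleton p).subset Pi.support_single_subset).isSmall

/-- The residue pairing is nondegenerate. -/
theorem eq_zero_of_residue_mul_eq_zero (U : PsiDO n k) (h : ∀ M, residue (M * U) = 0) :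
    U = 0 := by
  have h1 : twist (-1) (cf U) = 0 := by
    funext b
    obtain ⟨M, hM⟩ := exists_cf_single (k := k) (-1 - b)
    have := h M
    rw [residue_mul_eq, hM, finsum_eq_single _ (-1 - b)] at this
    · simpa using this
    · intro q hq
      rw [Pi.single_eq_of_ne hq, zero_mul]
  apply cf_injective
  rw [cf_zero, ← twist_twist 1 (cf U) (isSmall_support_cf U), h1]
  funext b
  simp [twist]

/-- Every continuous functional is represented by the residue pairing. -/
theorem exists_residue_mul_eq (D : Bideg n → k)
    (hD : ∀ M : PsiDO n k, {p | D p * cf M p ≠ 0}.Finite) :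
    ∃ U : PsiDO n k, ∀ M, residue (M * U) = ∑ᶠ p, D p * cf M p := by
  classical
  -- Testing `D` on operators with all coefficients 1 on a small set `T` shows that its support
  -- meets every such `T` in a finite set.
  have hsmall : IsSmall {p | -1 - p ∈ Function.support D} := by
    refine isSmall_of_finite_inter _ _ fun T hT => ?_
    obtain ⟨M, hM⟩ := exists_cf_eq (k := k) (T.indicator 1) (hT.mono fun p hp => by
      by_contra h
      exact hp (Set.indicator_of_notMem h _))
    refine (hD M).subset fun p hp => ?_
    rw [Set.mem_ofPred_eq, hM, Set.indicator_of_mem hp.2, Pi.one_apply, mul_one]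
    exact hp.1
  -- The twist by `1` undoes the twist by `-1` in `residue_mul_eq`.
  obtain ⟨U, hU⟩ := exists_cf_eq (twist 1 fun b => D (-1 - b))
    (isSmall_support_twist 1 (fun b => D (-1 - b)) hsmall)
  refine ⟨U, fun M => ?_⟩
  rw [residue_mul_eq, hU]
  have := twist_twist (-1) (fun b => D (-1 - b)) hsmall
  rw [neg_neg] at this
  rw [this]
  refine finsum_congr fun p => ?_
  simp only [sub_sub_cancel, mul_comm]

theorem residue_add (L M : PsiDO n k) : residue (L + M) = residue L + residue M := rfl

theorem residue_sub (L M : PsiDO n k) : residue (L - M) = residue L - residue M := by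
  rw [sub_eq_add_neg, residue_add, sub_eq_add_neg]; rfl

theorem residue_smul (c : k) (L : PsiDO n k) : residue (c • L) = c * residue L := rfl

theorem residue_zero : residue (0 : PsiDO n k) = 0 := rfl

theorem eq_of_pairing_eq (U V : Fin n → PsiDO n k) (h : ∀ M, pairing M U = pairing M V) :
    U = V := by
  classical
  funext i
  rw [← sub_eq_zero]
  refine eq_zero_of_residue_mul_eq_zero _ fun M => ?_
  have h1 : ∀ V : Fin n → PsiDO n k, pairing (Pi.single i M) V = residue (M * V i) := by
    intro V
    rw [pairing, Finset.sum_eq_single i]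
    · rw [Pi.single_eq_same]
    · intro j _ hj
      rw [Pi.single_eq_of_ne hj, zero_mul, residue_zero]
    · exact fun h => absurd (Finset.mem_univ i) h
  rw [mul_sub, residue_sub, ← h1, ← h1, h, sub_self]

theorem exists_pairing_eq (D : CoordIndex n → k)
    (hD : ∀ M : Fin n → PsiDO n k, {v | D v * coord M v ≠ 0}.Finite) :
    ∃ U : Fin n → PsiDO n k, ∀ M, pairing M U = ∑ᶠ v, D v * coord M v := by
  have h1 : ∀ i, ∃ U : PsiDO n k, ∀ M, residue (M * U) = ∑ᶠ p, D (i, p) * cf M p := by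
    intro i
    refine exists_residue_mul_eq _ fun M => ?_
    exact Set.Finite.preimage (f := fun p : Bideg n => (i, p))
      (fun p _ q _ h => (Prod.mk.inj h).2) (hD fun _ => M)
  choose U hU using h1
  refine ⟨U, fun M => ?_⟩
  rw [finsum_curry _ (hD M), finsum_eq_sum_of_fintype]
  exact Finset.sum_congr rfl fun i _ => hU i (M i)

/-! ### Existence and uniqueness of gradients -/

theorem coord_add_smul (L M : Fin n → PsiDO n k) (ε : k) (v : CoordIndex n) :
    coord (L + ε • M) v = coord L v + ε * coord M v := rfl

open Polynomial in
/-- The restriction of a monomial to the line `L + ε M`. -/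
noncomputable def linePoly (c : (CoordIndex n →₀ ℕ) → k) (L M : Fin n → PsiDO n k)
    (m : CoordIndex n →₀ ℕ) : Polynomial k :=
  C (c m) * m.prod fun v e => (C (coord L v) + X * C (coord M v)) ^ e

theorem eval_linePoly (c : (CoordIndex n →₀ ℕ) → k) (L M : Fin n → PsiDO n k)
    (m : CoordIndex n →₀ ℕ) (ε : k) :
    (linePoly c L M m).eval ε = monomialValue c (L + ε • M) m := by
  simp only [linePoly, monomialValue, Finsupp.prod, Polynomial.eval_mul, Polynomial.eval_C,
    Polynomial.eval_prod, Polynomial.eval_pow, Polynomial.eval_add, Polynomial.eval_X,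
    coord_add_smul]

open Polynomial in
theorem natDegree_linePoly_le (c : (CoordIndex n →₀ ℕ) → k) (L M : Fin n → PsiDO n k)
    (m : CoordIndex n →₀ ℕ) : (linePoly c L M m).natDegree ≤ m.degree := by
  refine (natDegree_C_mul_le _ _).trans ((natDegree_prod_le _ _).trans ?_)
  refine Finset.sum_le_sum fun v _ => ?_
  refine natDegree_pow_le.trans ?_
  have : (C (coord L v) + X * C (coord M v)).natDegree ≤ 1 := by
    compute_degree
  calc m v * _ ≤ m v * 1 := Nat.mul_le_mul_left _ this
    _ = m v := mul_one _

/-- A polynomial of degree at most `N` that vanishes at `0, …, N` is zero, so a monomial surviving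
on the line survives at one of `N + 1` points, each of which allows finitely many monomials. -/
theorem finite_linePoly_ne_zero [CharZero k] (c : (CoordIndex n →₀ ℕ) → k) (N : ℕ)
    (hN : ∀ m, c m ≠ 0 → m.degree ≤ N)
    (hc : ∀ L : Fin n → PsiDO n k, (Function.support (monomialValue c L)).Finite)
    (L M : Fin n → PsiDO n k) : {m | linePoly c L M m ≠ 0}.Finite := by
  refine ((Finset.range (N + 1)).finite_toSet.biUnion
    (t := fun j : ℕ => Function.support (monomialValue c (L + (j : k) • M)))
    fun j _ => hc _).subset fun m hm => ?_
  by_contra hcon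
  apply hm
  have hcm : c m ≠ 0 := fun h => hm (by simp [linePoly, h])
  refine Polynomial.eq_zero_of_natDegree_lt_card_of_eval_eq_zero _
    (f := fun j : Fin (N + 1) => ((j : ℕ) : k)) ?_ ?_ ?_
  · intro i j h
    exact Fin.ext (Nat.cast_injective h)
  · intro j
    rw [eval_linePoly]
    by_contra h
    exact hcon (Set.mem_biUnion (x := (j : ℕ)) (by simpa using j.2) h)
  · rw [Fintype.card_fin]
    exact Nat.lt_succ_of_le ((natDegree_linePoly_le c L M m).trans (hN m hcm))

/-- The value at `L` of the partial derivative of a monomial. -/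
noncomputable def monomialDeriv (c : (CoordIndex n →₀ ℕ) → k) (L : Fin n → PsiDO n k)
    (m : CoordIndex n →₀ ℕ) (v : CoordIndex n) : k :=
  c m * ((∏ w ∈ m.support.erase v, coord L w ^ m w) * (m v * coord L v ^ (m v - 1)))

theorem monomialDeriv_eq_zero (c : (CoordIndex n →₀ ℕ) → k) (L : Fin n → PsiDO n k)
    (m : CoordIndex n →₀ ℕ) (v : CoordIndex n) (hv : v ∉ m.support) :
    monomialDeriv c L m v = 0 := by
  rw [Finsupp.notMem_support_iff] at hv
  simp [monomialDeriv, hv]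

theorem eval_derivative_linePoly (c : (CoordIndex n →₀ ℕ) → k) (L M : Fin n → PsiDO n k)
    (m : CoordIndex n →₀ ℕ) :
    (linePoly c L M m).derivative.eval 0 =
      ∑ᶠ v, monomialDeriv c L m v * coord M v := by
  rw [finsum_eq_sum_of_support_subset (s := m.support)]
  · simp only [linePoly, Finsupp.prod, Polynomial.derivative_C_mul, Polynomial.derivative_prod_finset,
      Polynomial.eval_mul, Polynomial.eval_C, Polynomial.eval_finsetSum, Finset.mul_sum]
    refine Finset.sum_congr rfl fun v _ => ?_
    simp only [Polynomial.eval_prod, Polynomial.derivative_pow, Polynomial.eval_mul,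
      Polynomial.eval_pow, Polynomial.eval_add, Polynomial.eval_C, Polynomial.eval_X,
      Polynomial.derivative_add, Polynomial.derivative_C, Polynomial.derivative_X,
      Polynomial.derivative_mul, monomialDeriv, zero_mul, add_zero, mul_zero, zero_add, one_mul]
    ring
  · intro v hv
    by_contra h
    exact hv (by simp only [monomialDeriv_eq_zero _ _ _ _ h, zero_mul])

/-- No linear factor is zero: that of `v` has slope `coord M v ≠ 0`, the others have nonzero value
at `ε = 0`. Hence terms of the differential come only from monomials surviving on the line. -/
theorem linePoly_ne_zero (c : (CoordIndex n →₀ ℕ) → k) (L M : Fin n → PsiDO n k)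
    (m : CoordIndex n →₀ ℕ) (v : CoordIndex n) (h : monomialDeriv c L m v * coord M v ≠ 0) :
    linePoly c L M m ≠ 0 := by
  have h1 := left_ne_zero_of_mul h
  have hM := right_ne_zero_of_mul h
  have hc : c m ≠ 0 := left_ne_zero_of_mul h1
  have hp := left_ne_zero_of_mul (right_ne_zero_of_mul h1)
  rw [Finset.prod_ne_zero_iff] at hp
  refine mul_ne_zero (Polynomial.C_ne_zero.mpr hc) (Finset.prod_ne_zero_iff.mpr fun w hw => ?_)
  refine pow_ne_zero _ fun h0 => ?_
  by_cases hwv : w = v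
  · subst hwv
    have := congrArg (fun p => Polynomial.coeff p 1) h0
    simp at this
    exact hM this
  · have := congrArg (fun p => Polynomial.coeff p 0) h0
    simp at this
    have hw' := hp w (Finset.mem_erase.mpr ⟨hwv, hw⟩)
    rw [this, zero_pow (Finsupp.mem_support_iff.mp hw)] at hw'
    exact hw' rfl

theorem hasDerivAlong_unique [CharZero k] {F : (Fin n → PsiDO n k) → k}
    {L M : Fin n → PsiDO n k} {c d : k} (hc : HasDerivAlong F L M c)
    (hd : HasDerivAlong F L M d) : c = d := by
  obtain ⟨p, hp, rfl⟩ := hc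
  obtain ⟨q, hq, rfl⟩ := hd
  rw [Polynomial.funext fun ε => (hp ε).symm.trans (hq ε)]

theorem isGradient_unique [CharZero k] {F : (Fin n → PsiDO n k) → k}
    {L U V : Fin n → PsiDO n k} (hU : IsGradient F L U) (hV : IsGradient F L V) : U = V :=
  eq_of_pairing_eq U V fun M => hasDerivAlong_unique (hU M) (hV M)

theorem gradient_eq [CharZero k] {F : (Fin n → PsiDO n k) → k}
    {L U : Fin n → PsiDO n k} (hU : IsGradient F L U) : gradient F L = U := by
  have h : ∃ U, IsGradient F L U := ⟨U, hU⟩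
  rw [gradient, dif_pos h]
  exact isGradient_unique h.choose_spec hU

/-- Termwise differentiation along each line is a finite sum, so the formal partial derivatives
satisfy the finiteness hypothesis of `exists_pairing_eq`. -/
theorem exists_isGradient [CharZero k] {F : (Fin n → PsiDO n k) → k}
    (hF : F ∈ functionals n k) (L : Fin n → PsiDO n k) : ∃ U, IsGradient F L U := by
  obtain ⟨c, ⟨N, hN⟩, hc⟩ := hF
  have hS := finite_linePoly_ne_zero c N hN (fun L => (hc L).1) L
  have hfin : ∀ M : Fin n → PsiDO n k,
      (Function.support fun z : CoordIndex n × (CoordIndex n →₀ ℕ) =>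
        monomialDeriv c L z.2 z.1 * coord M z.1).Finite := by
    intro M
    refine ((hS M).biUnion (t := fun m => (m.support : Set (CoordIndex n)) ×ˢ {m})
      fun m _ => m.support.finite_toSet.prod (Set.finite_singleton m)).subset ?_
    rintro ⟨v, m⟩ hz
    refine Set.mem_biUnion (x := m) (linePoly_ne_zero c L M m v hz) ⟨?_, rfl⟩
    by_contra h
    exact hz (by simp only [monomialDeriv_eq_zero _ _ _ _ h, zero_mul])
  obtain ⟨U, hU⟩ := exists_pairing_eq (fun v => ∑ᶠ m, monomialDeriv c L m v) (by
    intro M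
    refine ((hfin M).image Prod.fst).subset fun v hv => ?_
    rw [Set.mem_ofPred_eq, finsum_mul] at hv
    obtain ⟨m, hm⟩ : ∃ m, monomialDeriv c L m v * coord M v ≠ 0 := by
      by_contra h
      exact hv (finsum_eq_zero_of_forall_eq_zero fun q => not_not.mp (not_exists.mp h q))
    exact ⟨(v, m), hm, rfl⟩)
  refine ⟨U, fun M => ⟨∑ m ∈ (hS M).toFinset, linePoly c L M m, fun ε => ?_, ?_⟩⟩
  · rw [(hc _).2, Polynomial.eval_finsetSum, finsum_eq_sum_of_support_subset
      (s := (hS M).toFinset)]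
    · exact Finset.sum_congr rfl fun m _ => (eval_linePoly c L M m ε).symm
    · intro m hm
      rw [Set.Finite.coe_toFinset]
      intro h0
      apply hm
      rw [← eval_linePoly, h0, Polynomial.eval_zero]
  · rw [hU, Polynomial.derivative_sum, Polynomial.eval_finsetSum]
    simp only [finsum_mul]
    rw [← finsum_curry _ (hfin M), ← finsum_comp_equiv (Equiv.prodComm _ _), finsum_curry,
      finsum_eq_sum_of_support_subset (s := (hS M).toFinset)]
    · exact Finset.sum_congr rfl fun m _ => eval_derivative_linePoly c L M m
    · intro m hm
      rw [Set.Finite.coe_toFinset]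
      intro h0
      apply hm
      refine (eval_derivative_linePoly c L M m).symm.trans ?_
      rw [h0, Polynomial.derivative_zero, Polynomial.eval_zero]
    · exact Set.Finite.preimage (Equiv.injective _).injOn (hfin M)

/-! ### The Hamiltonians are functionals -/

/-- The maps `Pⁿ → P` all of whose coefficients are polynomials, of bounded degree, in possibly
infinitely many coordinates. -/
def IsPolynomialMap (Φ : (Fin n → PsiDO n k) → PsiDO n k) : Prop :=
  ∃ (J : Type) (c : J → k) (m : J → CoordIndex n →₀ ℕ) (e : J → Bideg n),
    (∃ N, ∀ j, (m j).degree ≤ N) ∧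
    ∀ L, IsExpansion (fun j => c j * (m j).prod fun v a => coord L v ^ a) e (Φ L)

theorem isPolynomialMap_one : IsPolynomialMap fun _ : Fin n → PsiDO n k => 1 := by
  classical
  refine ⟨Unit, fun _ => 1, fun _ => 0, fun _ => 0, ⟨0, by simp⟩, fun L => ⟨?_, ?_, ?_⟩⟩
  · exact (Set.toFinite _).isSmall
  · exact fun p => Set.toFinite _
  · intro p
    rw [cf_one, finsum_unique]
    simp [eq_comm]

theorem isPolynomialMap_apply (i : Fin n) :
    IsPolynomialMap fun L : Fin n → PsiDO n k => L i := by
  refine ⟨Bideg n, fun _ => 1, fun p => Finsupp.single (i, p) 1, id, ⟨1, by simp⟩, fun L => ?_⟩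
  convert isExpansion_cf (L i) using 1
  funext p
  simp [coord, cf]

theorem IsPolynomialMap.mul {Φ Ψ : (Fin n → PsiDO n k) → PsiDO n k} (hΦ : IsPolynomialMap Φ)
    (hΨ : IsPolynomialMap Ψ) : IsPolynomialMap fun L => Φ L * Ψ L := by
  obtain ⟨J, c, m, e, ⟨N, hN⟩, h⟩ := hΦ
  obtain ⟨J', c', m', e', ⟨N', hN'⟩, h'⟩ := hΨ
  refine ⟨J × J' × (Fin n → ℕ),
    fun z => (multiWeight (e z.1) (e' z.2.1) z.2.2 : k) * (c z.1 * c' z.2.1),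
    fun z => m z.1 + m' z.2.1, fun z => e z.1 + e' z.2.1 - diag z.2.2,
    ⟨N + N', fun z => ?_⟩, fun L => ?_⟩
  · rw [map_add]
    exact add_le_add (hN _) (hN' _)
  · convert (h L).mul (h' L) using 1
    funext z
    rw [Finsupp.prod_add_index' (fun _ => pow_zero _) fun _ _ _ => pow_add _ _ _]
    ring

theorem isPolynomialMap_multiPow (κ : Fin n → ℕ) :
    IsPolynomialMap fun L : Fin n → PsiDO n k => multiPow L κ := by
  have hpow : ∀ (i : Fin n) (m : ℕ),
      IsPolynomialMap fun L : Fin n → PsiDO n k => npowRec m (L i) := by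
    intro i m
    induction m with
    | zero => exact isPolynomialMap_one
    | succ m ih => exact ih.mul (isPolynomialMap_apply i)
  simp only [multiPow, List.ofFn_eq_map]
  induction List.finRange n with
  | nil => exact isPolynomialMap_one
  | cons i l ih =>
    simp only [List.map_cons, List.prod_cons]
    exact (hpow i (κ i)).mul ih

theorem IsPolynomialMap.residue_mem_functionals {Φ : (Fin n → PsiDO n k) → PsiDO n k}
    (hΦ : IsPolynomialMap Φ) : (fun L => residue (Φ L)) ∈ functionals n k := by
  classical
  obtain ⟨J, c, m, e, ⟨N, hN⟩, h⟩ := hΦ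
  refine ⟨fun μ => ∑ᶠ j, if m j = μ then if e j = -1 then c j else 0 else 0,
    ⟨N, fun μ hμ => ?_⟩, fun L => ?_⟩
  · by_contra hdeg
    refine hμ (finsum_eq_zero_of_forall_eq_zero fun j => if_neg fun hj => hdeg ?_)
    rw [← hj]
    exact hN j
  · let f : J → k := fun j => if e j = -1 then c j * (m j).prod fun v a => coord L v ^ a else 0
    have hf : (Function.support f).Finite := by
      refine ((h L).finite (-1)).subset fun j hj => ?_
      rw [Function.mem_support, ne_eq, ite_eq_right_iff, Classical.not_imp] at hj
      exact ⟨hj.2, hj.1⟩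
    have hval : ∀ μ, monomialValue
        (fun μ => ∑ᶠ j, if m j = μ then if e j = -1 then c j else 0 else 0) L μ =
          ∑ᶠ j, if m j = μ then f j else 0 := by
      intro μ
      -- In a field `finsum_mul` needs no finiteness, so the fibres of `m` need not be known to be
      -- finite here.
      rw [monomialValue, finsum_mul]
      refine finsum_congr fun j => ?_
      by_cases hj : m j = μ
      · rw [if_pos hj, if_pos hj, ite_mul, zero_mul, ← hj]
      · rw [if_neg hj, if_neg hj, zero_mul]
    constructor
    · refine (hf.image m).subset fun μ hμ => ?_
      rw [Function.mem_support, hval] at hμ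
      obtain ⟨j, hj⟩ : ∃ j, (if m j = μ then f j else 0) ≠ 0 := by
        by_contra h
        exact hμ (finsum_eq_zero_of_forall_eq_zero fun q => not_not.mp (not_exists.mp h q))
      rw [ne_eq, ite_eq_right_iff, Classical.not_imp] at hj
      exact ⟨j, hj.2, hj.1⟩
    · rw [finsum_congr hval]
      refine ((h L).cf_eq (-1)).trans ?_
      refine Eq.trans ?_ ((finsum_fiberwise m f hf).trans ?_)
      · exact finsum_congr fun j => by simp only [f]
      · exact finsum_congr fun μ => finsum_congr fun j => by congr

theorem hamiltonian_mem_functionals (κ : Fin n → ℕ) :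
    (hamiltonian κ : (Fin n → PsiDO n k) → k) ∈ functionals n k :=
  (isPolynomialMap_multiPow κ).residue_mem_functionals

/-! ### Gradients of the Hamiltonians on the commuting variety -/

/-- The curve `Φ` is polynomial, with value `A` and derivative `B` at `0`. -/
def HasPolynomialJet (Φ : k → PsiDO n k) (A B : PsiDO n k) : Prop :=
  ∃ q : Polynomial (PsiDO n k),
    (∀ ε, Φ ε = q.eval (algebraMap k _ ε)) ∧ q.coeff 0 = A ∧ q.coeff 1 = B

theorem HasPolynomialJet.mul {Φ Ψ : k → PsiDO n k} {A B A' B' : PsiDO n k}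
    (h : HasPolynomialJet Φ A B) (h' : HasPolynomialJet Ψ A' B') :
    HasPolynomialJet (fun ε => Φ ε * Ψ ε) (A * A') (A * B' + B * A') := by
  obtain ⟨q, hq, rfl, rfl⟩ := h
  obtain ⟨q', hq', rfl, rfl⟩ := h'
  refine ⟨q * q', fun ε => ?_, Polynomial.mul_coeff_zero _ _, Polynomial.mul_coeff_one _ _⟩
  simp only [hq, hq']
  -- Evaluation is multiplicative over a noncommutative ring because `ε` is central.
  exact (Polynomial.eval₂_mul_noncomm _ _ fun j => (Algebra.commutes ε _).symm).symm

theorem HasPolynomialJet.hasDerivAlong {Φ : (Fin n → PsiDO n k) → PsiDO n k}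
    {L M : Fin n → PsiDO n k} {A B : PsiDO n k}
    (h : HasPolynomialJet (fun ε => Φ (L + ε • M)) A B) :
    HasDerivAlong (fun L => residue (Φ L)) L M (residue B) := by
  obtain ⟨q, hq, -, rfl⟩ := h
  -- The bound `natDegree + 2` keeps the index 1 in range even when `q` is constant.
  refine ⟨∑ j ∈ Finset.range (q.natDegree + 2), Polynomial.monomial j (residue (q.coeff j)),
    fun ε => ?_, ?_⟩
  · have h1 := hq ε
    rw [Polynomial.eval_eq_sum_range' (lt_add_of_pos_right _ two_pos)] at h1
    simp only at h1 ⊢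
    rw [h1, Polynomial.eval_finsetSum]
    refine (map_sum (AddMonoidHom.mk' (residue (n := n) (k := k)) residue_add) _ _).trans ?_
    refine Finset.sum_congr rfl fun j _ => ?_
    rw [Polynomial.eval_monomial, AddMonoidHom.mk'_apply, ← map_pow, ← Algebra.commutes,
      ← Algebra.smul_def, residue_smul, mul_comm]
  · rw [← Polynomial.coeff_zero_eq_eval_zero, Polynomial.coeff_derivative,
      Polynomial.finsetSum_coeff]
    simp [Polynomial.coeff_monomial]

/-- `Φ` behaves at `L` as a noncommutative polynomial in commuting variables does: `Φ L` is in the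
double commutant of `L₁, …, Lₙ`, and the functional that the differential of `Φ` at `L` induces,
paired with any `Z` in the commutant, is given by `U₁ Z, …, Uₙ Z` with `Uᵢ` in the commutant. -/
def HasCommutingGradient (L : Fin n → PsiDO n k) (Φ : (Fin n → PsiDO n k) → PsiDO n k) : Prop :=
  (∀ Z, (∀ j, Commute Z (L j)) → Commute Z (Φ L)) ∧ (∀ j, Commute (Φ L) (L j)) ∧
  ∃ U : Fin n → PsiDO n k, (∀ i j, Commute (U i) (L j)) ∧
    ∀ M, ∃ B, HasPolynomialJet (fun ε => Φ (L + ε • M)) (Φ L) B ∧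
      ∀ Z, (∀ j, Commute Z (L j)) → residue (B * Z) = pairing M fun i => U i * Z

theorem pairing_add (M U V : Fin n → PsiDO n k) :
    pairing M (U + V) = pairing M U + pairing M V := by
  simp only [pairing, Pi.add_apply, mul_add, residue_add, Finset.sum_add_distrib]

theorem pairing_smul (c : k) (M U : Fin n → PsiDO n k) :
    pairing M (c • U) = c * pairing M U := by
  simp only [pairing, Pi.smul_apply, mul_smul_comm, residue_smul, Finset.mul_sum]

theorem hasCommutingGradient_one (L : Fin n → PsiDO n k) :
    HasCommutingGradient L fun _ => 1 := by
  refine ⟨fun Z _ => Commute.one_right Z, fun j => Commute.one_left _,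
    0, fun i j => Commute.zero_left _, fun M => ⟨0, ⟨1, fun ε => ?_, ?_, ?_⟩, fun Z _ => ?_⟩⟩
  · simp
  · simp
  · simp [Polynomial.coeff_one]
  · simp [pairing, residue_zero]

theorem hasCommutingGradient_apply (L : Fin n → PsiDO n k) (hL : ∀ i j, Commute (L i) (L j))
    (i : Fin n) : HasCommutingGradient L fun L => L i := by
  classical
  refine ⟨fun Z hZ => hZ i, hL i, Pi.single i 1, fun i' j => ?_, fun M =>
    ⟨M i, ⟨Polynomial.C (L i) + Polynomial.C (M i) * Polynomial.X, fun ε => ?_, ?_, ?_⟩,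
      fun Z _ => ?_⟩⟩
  · by_cases h : i' = i
    · subst h
      rw [Pi.single_eq_same]
      exact Commute.one_left _
    · rw [Pi.single_eq_of_ne h]
      exact Commute.zero_left _
  · rw [Polynomial.eval_add, Polynomial.eval_C, Polynomial.eval_mul_X, Polynomial.eval_C,
      ← Algebra.commutes, ← Algebra.smul_def]
    rfl
  · simp
  · simp [Polynomial.coeff_C]
  · rw [pairing, Finset.sum_eq_single i]
    · rw [Pi.single_eq_same, one_mul]
    · intro j _ hj
      rw [Pi.single_eq_of_ne hj, zero_mul, mul_zero, residue_zero]
    · exact fun h => absurd (Finset.mem_univ i) h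

/-- In the product rule the trace moves `Φ L` cyclically next to `Z`. The product stays in the
commutant, hence the quantification over `Z`; the double commutant condition then restores the order
of the two. -/
theorem HasCommutingGradient.mul {L : Fin n → PsiDO n k}
    {Φ Ψ : (Fin n → PsiDO n k) → PsiDO n k} (hΦ : HasCommutingGradient L Φ)
    (hΨ : HasCommutingGradient L Ψ) : HasCommutingGradient L fun L => Φ L * Ψ L := by
  obtain ⟨hc, hA, U, hU, h⟩ := hΦ
  obtain ⟨hc', hA', U', hU', h'⟩ := hΨ
  refine ⟨fun Z hZ => (hc Z hZ).mul_right (hc' Z hZ), fun j => (hA j).mul_left (hA' j),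
    fun i => U' i * Φ L + U i * Ψ L,
    fun i j => ((hU' i j).mul_left (hA j)).add_left ((hU i j).mul_left (hA' j)), fun M => ?_⟩
  obtain ⟨B, hB, hBr⟩ := h M
  obtain ⟨B', hB', hBr'⟩ := h' M
  refine ⟨_, hB.mul hB', fun Z hZ => ?_⟩
  have e1 : residue (Φ L * B' * Z) = pairing M fun i => U' i * Φ L * Z := by
    rw [mul_assoc, residue_mul_comm, mul_assoc,
      hBr' (Z * Φ L) fun j => (hZ j).mul_left (hA j), (hc Z hZ).eq]
    simp only [mul_assoc]
  have e2 : residue (B * Ψ L * Z) = pairing M fun i => U i * Ψ L * Z := by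
    rw [mul_assoc, hBr (Ψ L * Z) fun j => (hA' j).mul_left (hZ j)]
    simp only [mul_assoc]
  rw [add_mul, residue_add, e1, e2, ← pairing_add]
  congr 1
  funext i
  exact (add_mul _ _ _).symm

theorem hasCommutingGradient_multiPow (L : Fin n → PsiDO n k)
    (hL : ∀ i j, Commute (L i) (L j)) (κ : Fin n → ℕ) :
    HasCommutingGradient L fun L => multiPow L κ := by
  have hpow : ∀ (i : Fin n) (m : ℕ),
      HasCommutingGradient L fun L : Fin n → PsiDO n k => npowRec m (L i) := by
    intro i m
    induction m with
    | zero => exact hasCommutingGradient_one L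
    | succ m ih => exact ih.mul (hasCommutingGradient_apply L hL i)
  simp only [multiPow, List.ofFn_eq_map]
  induction List.finRange n with
  | nil => exact hasCommutingGradient_one L
  | cons i l ih =>
    simp only [List.map_cons, List.prod_cons]
    exact (hpow i (κ i)).mul ih

theorem commute_gradient_hamiltonian [CharZero k] (L : Fin n → PsiDO n k)
    (hL : ∀ i j, Commute (L i) (L j)) (κ : Fin n → ℕ) (i j : Fin n) :
    Commute (gradient (hamiltonian κ) L i) (L j) := by
  obtain ⟨-, -, U, hU, h⟩ := hasCommutingGradient_multiPow L hL κ
  have hgrad : IsGradient (hamiltonian κ) L U := by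
    intro M
    obtain ⟨B, hB, hr⟩ := h M
    -- The choice `Z = 1` identifies `U` as the gradient itself.
    have h1 := hr 1 fun j => Commute.one_left _
    simp only [mul_one] at h1
    rw [← h1]
    exact hB.hasDerivAlong
  rw [gradient_eq hgrad]
  exact hU i j

/-- Cyclicity gives `res(L [X, Y]) = res([L, X] Y)` in each component. -/
theorem pairing_lie_eq_zero_left (L X Y : Fin n → PsiDO n k) (h : ∀ i, Commute (X i) (L i)) :
    pairing L (lie X Y) = 0 := by
  refine Finset.sum_eq_zero fun i _ => ?_
  change residue (L i * (X i * Y i - Y i * X i)) = 0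
  rw [mul_sub, residue_sub, ← mul_assoc (L i) (Y i), residue_mul_comm (L i * Y i), ← mul_assoc,
    ← mul_assoc, (h i).eq, sub_self]

theorem pairing_lie_eq_zero_right (L X Y : Fin n → PsiDO n k) (h : ∀ i, Commute (Y i) (L i)) :
    pairing L (lie X Y) = 0 := by
  refine Finset.sum_eq_zero fun i _ => ?_
  change residue (L i * (X i * Y i - Y i * X i)) = 0
  rw [mul_sub, residue_sub, ← mul_assoc (L i) (X i), residue_mul_comm (L i * X i), ← mul_assoc,
    ← mul_assoc, (h i).eq, sub_self]

end PsiDO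

/-! ### The theorem -/

theorem proposition7 {k : Type*} [Field k] [CharZero k] (n : ℕ) :
    -- the brackets below are those of functionals, and gradients exist and are unique
    (∀ κ : Fin n → ℕ, PsiDO.hamiltonian κ ∈ PsiDO.functionals n k) ∧
    (∀ F ∈ PsiDO.functionals n k, ∀ L : Fin n → PsiDO n k, ∃! U, PsiDO.IsGradient F L U) ∧
    -- the commutation relations on the commuting variety
    ∀ L ∈ PsiDO.commutingVariety n k,
      (∀ κ : Fin n → ℕ, ∀ F ∈ PsiDO.functionals n k,
        PsiDO.poisson (PsiDO.hamiltonian κ) F L = 0) ∧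
      (∀ κ l : Fin n → ℕ,
        PsiDO.poissonR (PsiDO.hamiltonian κ) (PsiDO.hamiltonian l) L = 0) := by
  refine ⟨PsiDO.hamiltonian_mem_functionals, fun F hF L => ?_, fun L hL => ?_⟩
  · obtain ⟨U, hU⟩ := PsiDO.exists_isGradient hF L
    exact ⟨U, hU, fun V hV => PsiDO.isGradient_unique hV hU⟩
  · have hcomm : ∀ i j, Commute (L i) (L j) := fun i j => sub_eq_zero.mp (hL i j)
    have hgrad := fun κ i => PsiDO.commute_gradient_hamiltonian L hcomm κ i i
    refine ⟨fun κ F _ => PsiDO.pairing_lie_eq_zero_left _ _ _ (hgrad κ), fun κ l => ?_⟩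
    -- The first half contains the gradient for `l` itself on the right, the second that for `κ`
    -- itself on the left; no property of `rMatrix` enters.
    rw [PsiDO.poissonR, PsiDO.lieR, PsiDO.pairing_add, PsiDO.pairing_smul, PsiDO.pairing_smul,
      PsiDO.pairing_lie_eq_zero_right _ _ _ (hgrad l),
      PsiDO.pairing_lie_eq_zero_left _ _ _ (hgrad κ), mul_zero, add_zero]
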